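/- Let $G$ be a local Lie group with finite-dimensional real Lie algebra $\mathfrak g$, referred to normal coordinates (a neighbourhood of $e$ is identified with a neighbourhood of $0$ in $\mathfrak g$ by $\exp$). Let $H$ be a closed local Lie subgroup with Lie algebra $\mathfrak h$ (so $H=\exp\mathfrak h$ near $e$), and let $Q\ni e$ be a smooth local section of the left cosets of $H$ with tangent space $V=T_eQ$, so $\mathfrak g=V\oplus\mathfrak h$. Let $\Pi:\mathfrak g\to V$ be the projection parallel to $\mathfrak h$. Write $Q=\{\exp(\xi+\varphi(\xi)):\xi\in V\text{ near }0\}$, where $\varphi:V\to\mathfrak h$ is smooth near $0$, $\varphi(0)=0$, $d\varphi(0)=0$; then $\varphi(\xi)=R(\xi,\xi)+o(|\xi|^2)$ with $R:V\times V\to\mathfrak h$ bilinear and symmetric. We use $\xi\in V$ as coordinate on $Q$, and write $u\in V$ also for the point $\exp(u+\varphi(u))$ of $Q$. Let $x\times y=\Pi_Q(xy)$ be the local loop on $Q$, where $\Pi_Q:G\to Q$ is the projection parallel to $H$, and let $\mu$ be its multiplication in the coordinate $V$. On a neighbourhood of $(e,e)$ in $Q\times Q$ consider the 3-web of this loop with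 its Chern connection. Put $P^i_\alpha=\partial\mu^i/\partial x^\alpha$, $Q^i_\beta=\partial\mu^i/\partial y^\beta$, with inverse matrices $\widetilde P,\widetilde Q$, and $$\omega_1=P\,dx,\quad \omega_2=Q\,dy,\quad \Gamma^k_{ij}=-\widetilde P^\alpha_i\widetilde Q^\beta_j\frac{\partial^2\mu^k}{\partial x^\alpha\partial y^\beta},\quad \omega^k_j=\Gamma^k_{ij}\omega_1^i+\Gamma^k_{jl}\omega_2^l .$$ The torsion tensor is $a^k_{ij}=\frac12(\Gamma^k_{ij}-\Gamma^k_{ji})$, the curvature tensor $b$ is defined by $d\omega^k_j=\omega^i_j\wedge\omega^k_i+b^k_{jlm}\,\omega_1^l\wedge\omega_2^m$, and $\overset1\nabla_l a,\overset2\nabla_l a$ by $$da^k_{ij}+a^l_{ij}\omega^k_l-a^k_{lj}\omega^l_i-a^k_{il}\omega^l_j=\overset1\nabla_l a^k_{ij}\,\omega_1^l+\overset2\nabla_l a^k_{ij}\,\omega_2^l .$$ Below, $\overset1\nabla_la^i_{jk},\overset2\nabla_la^i_{jk}$ and $b$ are taken at $(e,e)$, $b(\xi,\eta,\zeta)^i=b^i_{jlm}\xi^j\eta^l\zeta^m$,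 and the torsion tensor at the neutral element of an arbitrary local loop is the value of its tensor $a$ at $(e,e)$. For $g\in G$ near $e$ let $a''_g$ be the torsion tensor at $e$ of the local loop $(x,y)\mapsto\Pi''_g(xy)$ on $Q$, where $\Pi''_g:G\to Q$ is the projection parallel to $gHg^{-1}$. For $u\in Q$ near $e$ let $\Psi_u(x)=(u\times x)u^{-1}$, $Q'_u=Qu^{-1}=\Psi_u(Q)$, and let $\tilde a_u$ be the torsion tensor at $e$ of the local loop $(p,q)\mapsto\Pi'_u(pq)$ on $Q'_u$ ($\Pi'_u:G\to Q'_u$ the projection parallel to $uHu^{-1}$), transported to $Q$ by $\Psi_u$. Then for all $\xi,\eta,\zeta\in V$: (0) For $g$ near $e$, $\mathfrak g=V\oplus\mathrm{Ad}_g\mathfrak h$ and $a''_g(\xi,\eta)=-\frac12\Pi''_g[\xi,\eta]$, where $\Pi''_g$ also denotes the linear projection on $V$ parallel to $\mathrm{Ad}_g\mathfrak h$. For $u\in Q$ near $e$, $d\Psi_u|_e$ is injective, $\mathfrak g=T_eQ'_u\oplus\mathrm{Ad}_u\mathfrak h$ with $T_eQ'_u=d\Psi_u|_e(V)$, and $\tilde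 a_u(\xi,\eta)=-\frac12(d\Psi_u|_e)^{-1}\widetilde\Pi_u[d\Psi_u|_e\xi,d\Psi_u|_e\eta]$, where $\widetilde\Pi_u$ is the linear projection on $T_eQ'_u$ parallel to $\mathrm{Ad}_u\mathfrak h$. Moreover $d\Psi_u|_e\,\xi=\xi+\frac12[u,\xi]+\frac12\Pi[u,\xi]+2R(u,\xi)+o(u)$ as $u\to0$ in $V$. (I) $$\overset2\nabla_la^i_{jk}\xi^j\eta^k\zeta^l=\frac{d}{dt}\Big|_{t=0}a''_{g_t}(\xi,\eta)=-\tfrac12\Pi[[\xi,\eta],\zeta]+\tfrac12\Pi[\Pi[\xi,\eta],\zeta],$$ both for $g_t=\exp(t\zeta)$ and for $g_t=\exp(t\zeta+\varphi(t\zeta))\in Q$; and $\overset2\nabla_la^i_{jk}=b^i_{[jk]l}$, i.e. the left side equals $\frac12(b(\xi,\eta,\zeta)-b(\eta,\xi,\zeta))$. (II) With $u_t\in Q$ the point of coordinate $t\zeta$, $$\overset1\nabla_la^i_{jk}\xi^j\eta^k\zeta^l=\frac{d}{dt}\Big|_{t=0}\tilde a_{u_t}(\xi,\eta)=-\tfrac14\Pi[[\xi,\zeta],\eta]+\tfrac14\Pi[\Pi[\xi,\zeta],\eta]-\Pi[R(\xi,\zeta),\eta]+\tfrac14\Pi[[\eta,\zeta],\xi]-\tfrac14\Pi[\Pi[\eta,\zeta],\xi]+\Pi[R(\eta,\zeta),\xi];$$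 and $\overset1\nabla_la^i_{jk}=b^i_{[j|l|k]}$, i.e. the left side equals $\frac12(b(\xi,\zeta,\eta)-b(\eta,\zeta,\xi))$. All the derivatives exist. -/

import Mathlib

open Filter Topology
open scoped ContDiff

noncomputable section

/-! ### Local Lie groups -/

/-- A local Lie group, written in a chart that sends the identity to `0`.  All axioms are required
only near the identity; values of `mul` and `inv` far away are irrelevant. -/
structure LocalLieGroup (𝔤 : Type*) [NormedAddCommGroup 𝔤] [NormedSpace ℝ 𝔤] where
  mul : 𝔤 → 𝔤 → 𝔤
  inv : 𝔤 → 𝔤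
  smooth_mul : ∀ᶠ p in 𝓝 (0 : 𝔤 × 𝔤), ContDiffAt ℝ ∞ (fun q : 𝔤 × 𝔤 => mul q.1 q.2) p
  smooth_inv : ∀ᶠ x in 𝓝 (0 : 𝔤), ContDiffAt ℝ ∞ inv x
  one_mul : ∀ᶠ x in 𝓝 (0 : 𝔤), mul 0 x = x
  mul_one : ∀ᶠ x in 𝓝 (0 : 𝔤), mul x 0 = x
  mul_assoc : ∀ᶠ p in 𝓝 (0 : 𝔤 × 𝔤 × 𝔤), mul (mul p.1 p.2.1) p.2.2 = mul p.1 (mul p.2.1 p.2.2)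
  inv_zero : inv 0 = 0
  mul_inv : ∀ᶠ x in 𝓝 (0 : 𝔤), mul x (inv x) = 0
  inv_mul : ∀ᶠ x in 𝓝 (0 : 𝔤), mul (inv x) x = 0

namespace LocalLieGroup

variable {𝔤 : Type*} [NormedAddCommGroup 𝔤] [NormedSpace ℝ 𝔤] (G : LocalLieGroup 𝔤)

/-- The left-invariant vector field with value `x` at the identity. -/
def leftInvariantField (x : 𝔤) : 𝔤 → 𝔤 := fun g => fderiv ℝ (fun h => G.mul g h) 0 x

/-- The Lie bracket on the tangent space at the identity. -/
def bracket (x y : 𝔤) : 𝔤 :=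
  VectorField.lieBracket ℝ (G.leftInvariantField x) (G.leftInvariantField y) 0

/-- The chart is the one given by the exponential map (normal coordinates, i.e. canonical
coordinates of the first kind): the straight lines through `0` are the one-parameter subgroups.
In such a chart the exponential map is the identity map of `𝔤`. -/
def IsNormal : Prop :=
  ∀ᶠ x in 𝓝 (0 : 𝔤), ∀ s ∈ Set.Icc (-1 : ℝ) 1, ∀ t ∈ Set.Icc (-1 : ℝ) 1,
    G.mul (s • x) (t • x) = (s + t) • x

/-- In normal coordinates: near the identity, `exp 𝔥` is a local subgroup of `G` (stability under
inverses is automatic since `exp (-h)` is the inverse of `exp h`). -/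
def IsLocalSubgroup (𝔥 : Submodule ℝ 𝔤) : Prop :=
  ∀ᶠ p in 𝓝 (0 : 𝔥 × 𝔥), G.mul (p.1 : 𝔤) (p.2 : 𝔤) ∈ 𝔥

/-- Conjugation `h ↦ g h g⁻¹`. -/
def conj (g h : 𝔤) : 𝔤 := G.mul (G.mul g h) (G.inv g)

/-- The adjoint action of `g` on `𝔤`. -/
def Ad (g : 𝔤) : 𝔤 →L[ℝ] 𝔤 := fderiv ℝ (G.conj g) 0

variable {V 𝔥 : Submodule ℝ 𝔤}

/-- Let `s : V → G` parametrise a submanifold through the identity and `k : 𝔥 → G` a local subgroup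
transversal to it.  `cosetProj s k` is the projection of `G` on the submanifold parallel to the
subgroup, in the parameter `V`: it sends `s x · k h` to `x`.  This determines it near the identity,
because `(x, h) ↦ s x · k h` is a local diffeomorphism at `(0, 0)`. -/
def cosetProj (s : V → 𝔤) (k : 𝔥 → 𝔤) : 𝔤 → V :=
  Classical.epsilon fun π : 𝔤 → V => ∀ᶠ p in 𝓝 (0 : V × 𝔥), π (G.mul (s p.1) (k p.2)) = p.1

/-- The local loop of the section parametrised by `s`, with respect to the subgroup parametrised by
`k`: multiply in `G` and project on the section parallel to the subgroup. -/
def cosetLoop (s : V → 𝔤) (k : 𝔥 → 𝔤) : V → V → V :=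
  fun x y => G.cosetProj s k (G.mul (s x) (s y))

end LocalLieGroup

section Sections

variable {𝔤 : Type*} [NormedAddCommGroup 𝔤] [NormedSpace ℝ 𝔤] {V 𝔥 : Submodule ℝ 𝔤}

/-- The parametrisation `ξ ↦ exp (ξ + φ ξ)` of the section `Q`, in normal coordinates. -/
def sectionMap (φ : V → 𝔥) : V → 𝔤 := fun ξ => (ξ : 𝔤) + (φ ξ : 𝔤)

/-- The bilinear symmetric map `R` in the expansion `φ ξ = R (ξ, ξ) + S (ξ, ξ, ξ) + o(3)`. -/
def quadraticPart (φ : V → 𝔥) (ξ η : V) : 𝔥 := (1 / 2 : ℝ) • fderiv ℝ (fderiv ℝ φ) 0 ξ η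

open Classical in
/-- The linear projection of `𝔤` on `A` parallel to `B` (for complementary `A`, `B`). -/
def projAlong (A B : Submodule ℝ 𝔤) : 𝔤 → 𝔤 :=
  fun w => if h : IsCompl A B then (A.projectionOnto B h w : 𝔤) else 0

end Sections

/-! ### The three-web of a local loop and its Chern connection

`E` is a chart domain of the loop centred at the neutral element, `m` the loop multiplication.
The web lives on a neighbourhood of `(0, 0)` in `E × E`; its foliations are `x = const`, `y = const`
and `m x y = const`. -/
section Web

variable {E : Type*} [NormedAddCommGroup E] [NormedSpace ℝ E] (m : E → E → E)

/-- The matrix `P = ∂m/∂x`; the first coframe form is `ω₁ = P dx`. -/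
def webP (p : E × E) : E →L[ℝ] E := fderiv ℝ (fun x => m x p.2) p.1

/-- The matrix `Q = ∂m/∂y`; the second coframe form is `ω₂ = Q dy`. -/
def webQ (p : E × E) : E →L[ℝ] E := fderiv ℝ (fun y => m p.1 y) p.2

/-- The mixed second derivative `∂²m/∂x∂y` in the directions `X`, `Y`. -/
def mixedDeriv (p : E × E) (X Y : E) : E :=
  fderiv ℝ (fun y => fderiv ℝ (fun x => m x y) p.1 X) p.2 Y

/-- The connection coefficients `Γᵏᵢⱼ ξⁱ ηʲ = -(∂²mᵏ/∂xᵅ∂yᵝ) (P⁻¹ ξ)ᵅ (Q⁻¹ η)ᵝ`. -/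
def chernGamma (p : E × E) (ξ η : E) : E :=
  -mixedDeriv m p ((webP m p).inverse ξ) ((webQ m p).inverse η)

/-- The Chern connection form `ωᵏⱼ = Γᵏᵢⱼ ω₁ⁱ + Γᵏⱼₗ ω₂ˡ`, evaluated on the tangent vector `X` and
applied to `ξ ∈ E`. -/
def chernForm (p X : E × E) (ξ : E) : E :=
  chernGamma m p (webP m p X.1) ξ + chernGamma m p ξ (webQ m p X.2)

/-- The torsion tensor field `aᵏᵢⱼ ξⁱ ηʲ` of the web:
`aᵏᵢⱼ = -½ (∂²mᵏ/∂xᵅ∂yᵝ) (P̃ᵅᵢ Q̃ᵝⱼ - P̃ᵅⱼ Q̃ᵝᵢ)`. -/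
def chernTorsion (p : E × E) (ξ η : E) : E :=
  -((1 / 2 : ℝ) •
    (mixedDeriv m p ((webP m p).inverse ξ) ((webQ m p).inverse η)
      - mixedDeriv m p ((webP m p).inverse η) ((webQ m p).inverse ξ)))

/-- The curvature two-form `Ωᵏⱼ = dωᵏⱼ - ωⁱⱼ ∧ ωᵏᵢ`, evaluated on `X`, `Y` and applied to `ξ`. -/
def chernCurvatureForm (p X Y : E × E) (ξ : E) : E :=
  fderiv ℝ (fun q => chernForm m q Y ξ) p X - fderiv ℝ (fun q => chernForm m q X ξ) p Y
    + chernForm m p X (chernForm m p Y ξ) - chernForm m p Y (chernForm m p X ξ)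

/-- The curvature tensor field `bᵏⱼₗₘ ξʲ ηˡ ζᵐ` of the web, defined by
`dωᵏⱼ = ωⁱⱼ ∧ ωᵏᵢ + bᵏⱼₗₘ ω₁ˡ ∧ ω₂ᵐ`. -/
def chernCurvature (p : E × E) (ξ η ζ : E) : E :=
  chernCurvatureForm m p ((webP m p).inverse η, 0) (0, (webQ m p).inverse ζ) ξ

/-- The covariant derivative of the torsion field in the direction `X`:
`∇aᵏᵢⱼ = daᵏᵢⱼ + aˡᵢⱼ ωᵏₗ - aᵏₗⱼ ωˡᵢ - aᵏᵢₗ ωˡⱼ`. -/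
def covDerivTorsion (p X : E × E) (ξ η : E) : E :=
  fderiv ℝ (fun q => chernTorsion m q ξ η) p X + chernForm m p X (chernTorsion m p ξ η)
    - chernTorsion m p (chernForm m p X ξ) η - chernTorsion m p ξ (chernForm m p X η)

/-- `∇¹ₗ aⁱⱼₖ ξʲ ηᵏ ζˡ`, where `∇a = ∇¹ₗ a ω₁ˡ + ∇²ₗ a ω₂ˡ`. -/
def nablaOneTorsion (p : E × E) (ξ η ζ : E) : E :=
  covDerivTorsion m p ((webP m p).inverse ζ, 0) ξ η

/-- `∇²ₗ aⁱⱼₖ ξʲ ηᵏ ζˡ`, where `∇a = ∇¹ₗ a ω₁ˡ + ∇²ₗ a ω₂ˡ`. -/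
def nablaTwoTorsion (p : E × E) (ξ η ζ : E) : E :=
  covDerivTorsion m p (0, (webQ m p).inverse ζ) ξ η

end Web

/-! ### The loop of a section and the conjugated-subgroup loops -/
namespace LocalLieGroup

variable {𝔤 : Type*} [NormedAddCommGroup 𝔤] [NormedSpace ℝ 𝔤] (G : LocalLieGroup 𝔤)
  {V 𝔥 : Submodule ℝ 𝔤} (φ : V → 𝔥)

/-- The loop `x × y = Π_Q (x y)` on the section `Q` of `G mod H`, in the coordinate `V` of `Q`. -/
def sectionLoop : V → V → V := G.cosetLoop (sectionMap φ) (fun h : 𝔥 => (h : 𝔤))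

/-- The torsion tensor `a''_g` at the neutral element of the loop `(x, y) ↦ Π''_g (x y)` on `Q`,
where `Π''_g` is the projection on `Q` parallel to the conjugated subgroup `g H g⁻¹`. -/
def torsionTwo (g : 𝔤) (ξ η : V) : V :=
  chernTorsion (G.cosetLoop (sectionMap φ) (fun h : 𝔥 => G.conj g (h : 𝔤))) 0 ξ η

/-- The map `Ψ_u x = (u × x) u⁻¹` from `Q` to the section `Q'_u = Q u⁻¹`; here `u`, `x` are given
by their coordinates in `V`. -/
def psi (u x : V) : 𝔤 :=
  G.mul (sectionMap φ (G.sectionLoop φ u x)) (G.inv (sectionMap φ u))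

/-- The differential of `Ψ_u` at the neutral element. -/
def dPsi (u : V) : V →L[ℝ] 𝔤 := fderiv ℝ (G.psi φ u) 0

/-- The torsion tensor `ã_u` at the neutral element of the loop `(a, b) ↦ Π'_u (a b)` on `Q'_u`,
where `Π'_u` is the projection on `Q'_u` parallel to `u H u⁻¹`, transported to `Q` by `Ψ_u`. -/
def torsionOne (u : V) (ξ η : V) : V :=
  chernTorsion (G.cosetLoop (G.psi φ u) (fun h : 𝔥 => G.conj (sectionMap φ u) (h : 𝔤))) 0 ξ η

end LocalLieGroup

end

/-!
A local group acts on a local coset space, and the coset loop is the restriction of that action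
to a section: `x × y` is the coset of `s(x) · s(y)`. Its second and third derivatives at the origin
are therefore those of the action read through the section, and associativity of the action
expresses them by iterated brackets and the quadratic part of the section.

At the neutral element of a web the two covariant derivatives of the torsion and the curvature are
polynomials in the second and third mixed derivatives of the multiplication, which gives both
`∇a = b` identities and the closed formulas for `∇¹a` and `∇²a`.

The torsion of a coset loop is `-½` the bracket projected along the subgroup. For a family of
sections `sₜ` and conjugates `gₜHgₜ⁻¹` the projection is the first component of the inverse of
the splitting `(v, h) ↦ dsₜ(v) + Ad(gₜ) h`, so its derivative at `t = 0` follows from the formula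
for the derivative of an inverse. Both loop families of the theorem are of this kind: a constant
section for `a''`, and for `ã` the section `Ψ_u`, whose differential is needed to first order
in `u`.
-/

open Function (uncurry)

section HigherDerivatives

variable {E F G : Type*} [NormedAddCommGroup E] [NormedSpace ℝ E] [NormedAddCommGroup F]
  [NormedSpace ℝ F] [NormedAddCommGroup G] [NormedSpace ℝ G] {f : E → F} {g : F → G} {x : E} {y : F}

/-- The second derivative of `f` at `x`, curried as a bilinear map; for functions of class `C²` this
is the symmetric bilinear form of second order terms of the Taylor expansion, times two. -/
noncomputable def secondFDeriv (f : E → F) (x : E) : E →L[ℝ] E →L[ℝ] F :=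
  fderiv ℝ (fderiv ℝ f) x

/-- The third derivative of `f` at `x`, curried as a trilinear map; the first argument is the
direction of the last differentiation. -/
noncomputable def thirdFDeriv (f : E → F) (x : E) : E →L[ℝ] E →L[ℝ] E →L[ℝ] F :=
  fderiv ℝ (secondFDeriv f) x

lemma contDiffAt_comp_of_eq {n : WithTop ℕ∞} (hg : ContDiffAt ℝ n g y) (hf : ContDiffAt ℝ n f x)
    (hy : f x = y) : ContDiffAt ℝ n (g ∘ f) x :=
  (hy ▸ hg).comp x hf

lemma hasFDerivAt_fderiv (hf : ContDiffAt ℝ 2 f x) :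
    HasFDerivAt (fderiv ℝ f) (secondFDeriv f x) x :=
  ((hf.fderiv_right (m := 1) (by norm_num)).differentiableAt (by norm_num)).hasFDerivAt

lemma hasFDerivAt_secondFDeriv (hf : ContDiffAt ℝ 3 f x) :
    HasFDerivAt (secondFDeriv f) (thirdFDeriv f x) x :=
  (((hf.fderiv_right (m := 2) (by norm_num)).fderiv_right (m := 1)
    (by norm_num)).differentiableAt (by norm_num)).hasFDerivAt

lemma secondFDeriv_comm (hf : ContDiffAt ℝ 2 f x) (v w : E) :
    secondFDeriv f x v w = secondFDeriv f x w v :=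
  hf.isSymmSndFDerivAt (by simp) v w

lemma thirdFDeriv_left_comm (hf : ContDiffAt ℝ 3 f x) (u v w : E) :
    thirdFDeriv f x u v w = thirdFDeriv f x v u w :=
  congrArg (fun T : E →L[ℝ] F => T w)
    (secondFDeriv_comm (hf.fderiv_right (m := 2) (by norm_num)) u v)

lemma thirdFDeriv_right_comm (hf : ContDiffAt ℝ 3 f x) (u v w : E) :
    thirdFDeriv f x u v w = thirdFDeriv f x u w v := by
  have hsymm : (fun y => secondFDeriv f y v w) =ᶠ[𝓝 x] fun y => secondFDeriv f y w v := by
    filter_upwards [hf.eventually (by simp)] with y hy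
    exact secondFDeriv_comm (hy.of_le (by norm_num)) v w
  have hderiv (a b : E) := ((hasFDerivAt_secondFDeriv hf).clm_apply
    (hasFDerivAt_const a x)).clm_apply (hasFDerivAt_const b x)
  simpa using congr($((hderiv v w).congr_of_eventuallyEq hsymm.symm |>.unique (hderiv w v)) u)

lemma secondFDeriv_congr {f₁ : E → F} (h : f =ᶠ[𝓝 x] f₁) :
    secondFDeriv f x = secondFDeriv f₁ x :=
  h.fderiv.fderiv_eq

lemma thirdFDeriv_congr {f₁ : E → F} (h : f =ᶠ[𝓝 x] f₁) : thirdFDeriv f x = thirdFDeriv f₁ x :=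
  h.fderiv.fderiv.fderiv_eq

lemma secondFDeriv_clm (L : E →L[ℝ] F) : secondFDeriv L = 0 := by
  ext1 x
  rw [secondFDeriv, show fderiv ℝ L = fun _ => L from funext fun _ => L.fderiv]
  exact fderiv_const_apply L

lemma thirdFDeriv_clm (L : E →L[ℝ] F) : thirdFDeriv L = 0 := by
  ext1 x
  rw [thirdFDeriv, secondFDeriv_clm, fderiv_zero]

lemma fderiv_comp_apply (hg : DifferentiableAt ℝ g y) (hf : DifferentiableAt ℝ f x)
    (hy : f x = y) (v : E) : fderiv ℝ (g ∘ f) x v = fderiv ℝ g y (fderiv ℝ f x v) := by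
  subst hy
  rw [fderiv_comp x hg hf, ContinuousLinearMap.comp_apply]

lemma secondFDeriv_comp (hg : ContDiffAt ℝ 2 g y) (hf : ContDiffAt ℝ 2 f x) (hy : f x = y)
    (v w : E) : secondFDeriv (g ∘ f) x v w
      = secondFDeriv g y (fderiv ℝ f x v) (fderiv ℝ f x w)
        + fderiv ℝ g y (secondFDeriv f x v w) := by
  subst hy
  have hfirst : (fun z => fderiv ℝ (g ∘ f) z w)
      =ᶠ[𝓝 x] fun z => fderiv ℝ g (f z) (fderiv ℝ f z w) := by
    filter_upwards [hf.eventually (by simp), hf.continuousAt.eventually (hg.eventually (by simp))]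
      with z hz hgz
    exact fderiv_comp_apply (hgz.differentiableAt two_ne_zero) (hz.differentiableAt two_ne_zero)
      rfl w
  have hleft := (hasFDerivAt_fderiv (hg.comp x hf)).clm_apply (hasFDerivAt_const w x)
  have hright := ((hasFDerivAt_fderiv hg).comp x
    (hf.differentiableAt two_ne_zero).hasFDerivAt).clm_apply
    ((hasFDerivAt_fderiv hf).clm_apply (hasFDerivAt_const w x))
  simpa [add_comm] using congr($((hleft.congr_of_eventuallyEq hfirst.symm).unique hright) v)

lemma thirdFDeriv_comp (hg : ContDiffAt ℝ 3 g y) (hf : ContDiffAt ℝ 3 f x) (hy : f x = y)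
    (u v w : E) : thirdFDeriv (g ∘ f) x u v w
      = thirdFDeriv g y (fderiv ℝ f x u) (fderiv ℝ f x v) (fderiv ℝ f x w)
        + secondFDeriv g y (secondFDeriv f x u v) (fderiv ℝ f x w)
        + secondFDeriv g y (fderiv ℝ f x v) (secondFDeriv f x u w)
        + secondFDeriv g y (fderiv ℝ f x u) (secondFDeriv f x v w)
        + fderiv ℝ g y (thirdFDeriv f x u v w) := by
  subst hy
  have hsecond : (fun z => secondFDeriv (g ∘ f) z v w)
      =ᶠ[𝓝 x] fun z => secondFDeriv g (f z) (fderiv ℝ f z v) (fderiv ℝ f z w)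
        + fderiv ℝ g (f z) (secondFDeriv f z v w) := by
    filter_upwards [hf.eventually (by simp), hf.continuousAt.eventually (hg.eventually (by simp))]
      with z hz hgz
    exact secondFDeriv_comp (hgz.of_le (by norm_num)) (hz.of_le (by norm_num)) rfl v w
  have hf₂ : ContDiffAt ℝ 2 f x := hf.of_le (by norm_num)
  have hg₂ : ContDiffAt ℝ 2 g (f x) := hg.of_le (by norm_num)
  have hf' := (hf.differentiableAt three_ne_zero).hasFDerivAt
  have hleft := ((hasFDerivAt_secondFDeriv (hg.comp x hf)).clm_apply
    (hasFDerivAt_const v x)).clm_apply (hasFDerivAt_const w x)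
  have hf'v := (hasFDerivAt_fderiv hf₂).clm_apply (hasFDerivAt_const v x)
  have hf'w := (hasFDerivAt_fderiv hf₂).clm_apply (hasFDerivAt_const w x)
  have hf''vw := ((hasFDerivAt_secondFDeriv hf).clm_apply
    (hasFDerivAt_const v x)).clm_apply (hasFDerivAt_const w x)
  have hright := ((((hasFDerivAt_secondFDeriv hg).comp x hf').clm_apply hf'v).clm_apply
    hf'w).add (((hasFDerivAt_fderiv hg₂).comp x hf').clm_apply hf''vw)
  have huvw := congr($((hleft.congr_of_eventuallyEq hsecond.symm).unique hright) u)
  simp only [ContinuousLinearMap.comp_zero, zero_add, ContinuousLinearMap.flip_apply,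
    Function.comp_apply, ContinuousLinearMap.flip_add, add_apply,
    ContinuousLinearMap.comp_apply] at huvw
  rw [huvw]
  abel

lemma secondFDeriv_comp_clm (L : G →L[ℝ] E) {z : G} (hf : ContDiffAt ℝ 2 f x) (hx : L z = x)
    (v w : G) : secondFDeriv (f ∘ L) z v w = secondFDeriv f x (L v) (L w) := by
  simpa [secondFDeriv_clm] using secondFDeriv_comp hf L.contDiff.contDiffAt hx v w

lemma thirdFDeriv_comp_clm (L : G →L[ℝ] E) {z : G} (hf : ContDiffAt ℝ 3 f x) (hx : L z = x)
    (u v w : G) : thirdFDeriv (f ∘ L) z u v w = thirdFDeriv f x (L u) (L v) (L w) := by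
  simpa [secondFDeriv_clm, thirdFDeriv_clm] using
    thirdFDeriv_comp hf L.contDiff.contDiffAt hx u v w

lemma secondFDeriv_clm_comp (L : F →L[ℝ] G) (hf : ContDiffAt ℝ 2 f x) (v w : E) :
    secondFDeriv (L ∘ f) x v w = L (secondFDeriv f x v w) := by
  simpa [secondFDeriv_clm] using secondFDeriv_comp L.contDiff.contDiffAt hf rfl v w

lemma thirdFDeriv_clm_comp (L : F →L[ℝ] G) (hf : ContDiffAt ℝ 3 f x) (u v w : E) :
    thirdFDeriv (L ∘ f) x u v w = L (thirdFDeriv f x u v w) := by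
  simpa [secondFDeriv_clm, thirdFDeriv_clm] using
    thirdFDeriv_comp L.contDiff.contDiffAt hf rfl u v w

lemma fderiv_prodMk_apply {h : E → G} (hf : DifferentiableAt ℝ f x) (hh : DifferentiableAt ℝ h x)
    (v : E) : fderiv ℝ (fun y => (f y, h y)) x v = (fderiv ℝ f x v, fderiv ℝ h x v) := by
  rw [hf.fderiv_prodMk hh, ContinuousLinearMap.prod_apply]

lemma secondFDeriv_prodMk {h : E → G} (hf : ContDiffAt ℝ 2 f x) (hh : ContDiffAt ℝ 2 h x)
    (v w : E) : secondFDeriv (fun y => (f y, h y)) x v w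
      = (secondFDeriv f x v w, secondFDeriv h x v w) :=
  Prod.ext (secondFDeriv_clm_comp (.fst ℝ F G) (hf.prodMk hh) v w).symm
    (secondFDeriv_clm_comp (.snd ℝ F G) (hf.prodMk hh) v w).symm

lemma thirdFDeriv_prodMk {h : E → G} (hf : ContDiffAt ℝ 3 f x) (hh : ContDiffAt ℝ 3 h x)
    (u v w : E) : thirdFDeriv (fun y => (f y, h y)) x u v w
      = (thirdFDeriv f x u v w, thirdFDeriv h x u v w) :=
  Prod.ext (thirdFDeriv_clm_comp (.fst ℝ F G) (hf.prodMk hh) u v w).symm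
    (thirdFDeriv_clm_comp (.snd ℝ F G) (hf.prodMk hh) u v w).symm

lemma hasFDerivAt_inverse_apply [CompleteSpace E] {T : G → E →L[ℝ] F} {T' : G →L[ℝ] E →L[ℝ] F}
    {z : G} (e : E ≃L[ℝ] F) (hT : HasFDerivAt T T' z) (he : T z = e) {w : G → F}
    {w' : G →L[ℝ] F} (hw : HasFDerivAt w w' z) :
    HasFDerivAt (fun q => (T q).inverse (w q))
      ((e.symm : F →L[ℝ] E) ∘L (w' - T'.flip (e.symm (w z)))) z := by
  have hinv : DifferentiableAt ℝ (fun q => (T q).inverse) z := by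
    have hT₀ : DifferentiableAt ℝ ContinuousLinearMap.inverse (T z) :=
      he ▸ (contDiffAt_map_inverse (n := 1) e).differentiableAt one_ne_zero
    exact hT₀.comp z hT.differentiableAt
  have hsol := hinv.hasFDerivAt.clm_apply hw
  have hinvertible : ∀ᶠ q in 𝓝 z, T q ∈ Set.range ((↑) : (E ≃L[ℝ] F) → E →L[ℝ] F) :=
    hT.continuousAt.eventually (he ▸ e.nhds)
  have heq : (fun q => T q ((T q).inverse (w q))) =ᶠ[𝓝 z] w := by
    filter_upwards [hinvertible] with q ⟨eq, heq⟩
    simp [← heq]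
  convert hsol using 1
  ext v
  have hv := congr(e.symm ($((hw.congr_of_eventuallyEq heq).unique (hT.clm_apply hsol)) v))
  rw [ContinuousLinearMap.comp_apply, sub_apply, ContinuousLinearEquiv.coe_coe, map_sub,
    sub_eq_iff_eq_add, hv]
  simp [he]

end HigherDerivatives

section TwoVariables

variable {E F G : Type*} [NormedAddCommGroup E] [NormedSpace ℝ E] [NormedAddCommGroup F]
  [NormedSpace ℝ F] [NormedAddCommGroup G] [NormedSpace ℝ G] {f : E → F → G} {p : E × F}

lemma fderiv_partial_left (hf : DifferentiableAt ℝ (uncurry f) p) :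
    fderiv ℝ (fun x => f x p.2) p.1 = fderiv ℝ (uncurry f) p ∘L .inl ℝ E F :=
  (hf.hasFDerivAt.comp (f := fun x => (x, p.2)) p.1 (hasFDerivAt_prodMk_left p.1 p.2)).fderiv

lemma fderiv_partial_right (hf : DifferentiableAt ℝ (uncurry f) p) :
    fderiv ℝ (f p.1) p.2 = fderiv ℝ (uncurry f) p ∘L .inr ℝ E F :=
  (hf.hasFDerivAt.comp (f := fun y => (p.1, y)) p.2 (hasFDerivAt_prodMk_right p.1 p.2)).fderiv

/-- The mixed second derivative `∂²f/∂x∂y` at the origin, as a bilinear map. -/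
noncomputable def crossHessian (f : E → F → G) : E →L[ℝ] F →L[ℝ] G :=
  fderiv ℝ (fun x => fderiv ℝ (f x) 0) 0

lemma hasFDerivAt_fderiv_uncurry_right (hf : ContDiffAt ℝ 2 (uncurry f) 0) :
    HasFDerivAt (fun x => fderiv ℝ (f x) 0)
      (((ContinuousLinearMap.compL ℝ F (E × F) G).flip (.inr ℝ E F)) ∘L
        secondFDeriv (uncurry f) 0 ∘L .inl ℝ E F) 0 := by
  have hpartial : (fun x => fderiv ℝ (f x) 0)
      =ᶠ[𝓝 0] fun x => fderiv ℝ (uncurry f) (x, 0) ∘L .inr ℝ E F := by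
    have hline : ContinuousAt (fun x : E => (x, (0 : F))) 0 := by fun_prop
    filter_upwards [hline.eventually (hf.eventually (by simp))] with x hx
    exact fderiv_partial_right (p := (x, 0)) (hx.differentiableAt two_ne_zero)
  exact (((ContinuousLinearMap.compL ℝ F (E × F) G).flip (.inr ℝ E F)).hasFDerivAt.comp (0 : E)
    ((hasFDerivAt_fderiv hf).comp (0 : E)
      (hasFDerivAt_prodMk_left (0 : E) (0 : F)))).congr_of_eventuallyEq hpartial

lemma hasFDerivAt_crossHessian (hf : ContDiffAt ℝ 2 (uncurry f) 0) :
    HasFDerivAt (fun x => fderiv ℝ (f x) 0) (crossHessian f) 0 :=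
  (hasFDerivAt_fderiv_uncurry_right hf).differentiableAt.hasFDerivAt

lemma crossHessian_apply (hf : ContDiffAt ℝ 2 (uncurry f) 0) (x : E) (y : F) :
    crossHessian f x y = secondFDeriv (uncurry f) 0 (x, 0) (0, y) :=
  congr($((hasFDerivAt_fderiv_uncurry_right hf).fderiv) x y)

end TwoVariables

section NeutralWeb

variable {E : Type*} [NormedAddCommGroup E] [NormedSpace ℝ E] {m : E → E → E}

lemma mixedDeriv_eq_secondFDeriv {p : E × E} (hm : ContDiffAt ℝ 2 (uncurry m) p) (X Y : E) :
    mixedDeriv m p X Y = secondFDeriv (uncurry m) p (X, 0) (0, Y) := by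
  have hpartial : (fun y => fderiv ℝ (fun x => m x y) p.1 X)
      =ᶠ[𝓝 p.2] fun y => fderiv ℝ (uncurry m) (p.1, y) (X, 0) := by
    have hline : ContinuousAt (fun y => (p.1, y)) p.2 := by fun_prop
    filter_upwards [hline.eventually (hm.eventually (by simp))] with y hy
    exact congr($(fderiv_partial_left (p := (p.1, y)) (hy.differentiableAt two_ne_zero)) X)
  have hderiv := ((hasFDerivAt_fderiv hm).comp (f := fun y => (p.1, y)) p.2
    (hasFDerivAt_prodMk_right p.1 p.2)).clm_apply (hasFDerivAt_const (X, (0 : E)) p.2)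
  rw [mixedDeriv, (hderiv.congr_of_eventuallyEq hpartial).fderiv, secondFDeriv_comm hm]
  simp

lemma webP_eq {p : E × E} (hm : DifferentiableAt ℝ (uncurry m) p) :
    webP m p = fderiv ℝ (uncurry m) p ∘L .inl ℝ E E :=
  fderiv_partial_left hm

lemma webQ_eq {p : E × E} (hm : DifferentiableAt ℝ (uncurry m) p) :
    webQ m p = fderiv ℝ (uncurry m) p ∘L .inr ℝ E E :=
  fderiv_partial_right hm

/-- A local loop of class `C³` with neutral element `0`. The solvability of the equations
`m a x = b` and `m x a = b` near `0` is not required, since it follows from the inverse function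
theorem. -/
structure IsLocalLoop (m : E → E → E) : Prop where
  contDiffAt : ContDiffAt ℝ 3 (uncurry m) 0
  right_neutral : ∀ᶠ x in 𝓝 (0 : E), m x 0 = x
  left_neutral : ∀ᶠ y in 𝓝 (0 : E), m 0 y = y

namespace IsLocalLoop

variable (hm : IsLocalLoop m)
include hm

lemma contDiffAt_two : ContDiffAt ℝ 2 (uncurry m) 0 :=
  hm.contDiffAt.of_le (by norm_num)

lemma differentiableAt : DifferentiableAt ℝ (uncurry m) 0 :=
  hm.contDiffAt.differentiableAt three_ne_zero

lemma uncurry_zero : uncurry m 0 = 0 :=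
  hm.left_neutral.self_of_nhds

lemma comp_inl : uncurry m ∘ ContinuousLinearMap.inl ℝ E E =ᶠ[𝓝 0] ContinuousLinearMap.id ℝ E :=
  hm.right_neutral

lemma comp_inr : uncurry m ∘ ContinuousLinearMap.inr ℝ E E =ᶠ[𝓝 0] ContinuousLinearMap.id ℝ E :=
  hm.left_neutral

lemma webP_zero : webP m 0 = .id ℝ E :=
  hm.comp_inl.fderiv_eq.trans (ContinuousLinearMap.fderiv _)

lemma webQ_zero : webQ m 0 = .id ℝ E :=
  hm.comp_inr.fderiv_eq.trans (ContinuousLinearMap.fderiv _)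

lemma fderiv_zero : fderiv ℝ (uncurry m) 0 = .fst ℝ E E + .snd ℝ E E := by
  rw [← ContinuousLinearMap.coprod_comp_inl_inr (fderiv ℝ (uncurry m) 0),
    ← webP_eq hm.differentiableAt, ← webQ_eq hm.differentiableAt, hm.webP_zero, hm.webQ_zero]
  rfl

lemma secondFDeriv_inl (X Y : E) : secondFDeriv (uncurry m) 0 (X, 0) (Y, 0) = 0 := by
  have hinl := secondFDeriv_comp_clm (.inl ℝ E E) hm.contDiffAt_two (z := 0) (by simp) X Y
  rw [secondFDeriv_congr hm.comp_inl, secondFDeriv_clm] at hinl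
  simpa using hinl.symm

lemma secondFDeriv_inr (X Y : E) : secondFDeriv (uncurry m) 0 (0, X) (0, Y) = 0 := by
  have hinr := secondFDeriv_comp_clm (.inr ℝ E E) hm.contDiffAt_two (z := 0) (by simp) X Y
  rw [secondFDeriv_congr hm.comp_inr, secondFDeriv_clm] at hinr
  simpa using hinr.symm

lemma secondFDeriv_zero (p q : E × E) : secondFDeriv (uncurry m) 0 p q
    = crossHessian m p.1 q.2 + crossHessian m q.1 p.2 := by
  conv_lhs => rw [← p.fst_add_snd, ← q.fst_add_snd]
  simp only [map_add, add_apply, hm.secondFDeriv_inl, hm.secondFDeriv_inr,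
    secondFDeriv_comm hm.contDiffAt_two (0, p.2), crossHessian_apply hm.contDiffAt_two]
  abel

lemma mixedDeriv_zero (ξ η : E) : mixedDeriv m 0 ξ η = crossHessian m ξ η := by
  rw [mixedDeriv_eq_secondFDeriv hm.contDiffAt_two, crossHessian_apply hm.contDiffAt_two]

lemma chernTorsion_zero (ξ η : E) :
    chernTorsion m 0 ξ η = -((1 / 2 : ℝ) • (crossHessian m ξ η - crossHessian m η ξ)) := by
  simp [chernTorsion, hm.webP_zero, hm.webQ_zero, hm.mixedDeriv_zero]

lemma chernForm_zero (X : E × E) (ξ : E) :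
    chernForm m 0 X ξ = -crossHessian m X.1 ξ - crossHessian m ξ X.2 := by
  simp [chernForm, chernGamma, hm.webP_zero, hm.webQ_zero, hm.mixedDeriv_zero, sub_eq_add_neg]

lemma eventually_webP_eq :
    webP m =ᶠ[𝓝 0] fun p => fderiv ℝ (uncurry m) p ∘L .inl ℝ E E := by
  filter_upwards [hm.contDiffAt.eventually (by simp)] with p hp
  exact webP_eq (hp.differentiableAt three_ne_zero)

lemma eventually_webQ_eq :
    webQ m =ᶠ[𝓝 0] fun p => fderiv ℝ (uncurry m) p ∘L .inr ℝ E E := by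
  filter_upwards [hm.contDiffAt.eventually (by simp)] with p hp
  exact webQ_eq (hp.differentiableAt three_ne_zero)

lemma hasFDerivAt_webP : HasFDerivAt (webP m)
    (((ContinuousLinearMap.compL ℝ E (E × E) E).flip (.inl ℝ E E)) ∘L
      secondFDeriv (uncurry m) 0) 0 :=
  (((ContinuousLinearMap.compL ℝ E (E × E) E).flip (.inl ℝ E E)).hasFDerivAt.comp (0 : E × E)
    (hasFDerivAt_fderiv hm.contDiffAt_two)).congr_of_eventuallyEq hm.eventually_webP_eq

lemma hasFDerivAt_webQ : HasFDerivAt (webQ m)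
    (((ContinuousLinearMap.compL ℝ E (E × E) E).flip (.inr ℝ E E)) ∘L
      secondFDeriv (uncurry m) 0) 0 :=
  (((ContinuousLinearMap.compL ℝ E (E × E) E).flip (.inr ℝ E E)).hasFDerivAt.comp (0 : E × E)
    (hasFDerivAt_fderiv hm.contDiffAt_two)).congr_of_eventuallyEq hm.eventually_webQ_eq

lemma hasFDerivAt_mixedDeriv {f g : E × E → E} {f' g' : E × E →L[ℝ] E}
    (hf : HasFDerivAt f f' 0) (hg : HasFDerivAt g g' 0) :
    HasFDerivAt (fun p => mixedDeriv m p (f p) (g p))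
      (((thirdFDeriv (uncurry m) 0).flip (f 0, 0)).flip (0, g 0)
        + (crossHessian m).flip (g 0) ∘L f' + crossHessian m (f 0) ∘L g') 0 := by
  have hcurried : (fun p => mixedDeriv m p (f p) (g p))
      =ᶠ[𝓝 0] fun p => secondFDeriv (uncurry m) p (f p, 0) (0, g p) := by
    filter_upwards [hm.contDiffAt.eventually (by simp)] with p hp
    exact mixedDeriv_eq_secondFDeriv (hp.of_le (by norm_num)) (f p) (g p)
  have hderiv := ((hasFDerivAt_secondFDeriv hm.contDiffAt).clm_apply
    ((ContinuousLinearMap.inl ℝ E E).hasFDerivAt.comp 0 hf)).clm_apply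
    ((ContinuousLinearMap.inr ℝ E E).hasFDerivAt.comp 0 hg)
  refine (hderiv.congr_of_eventuallyEq hcurried).congr_fderiv (ContinuousLinearMap.ext fun p => ?_)
  simp only [crossHessian_apply hm.contDiffAt_two, ContinuousLinearMap.comp_apply, add_apply,
    ContinuousLinearMap.flip_apply, ContinuousLinearMap.inl_apply, ContinuousLinearMap.inr_apply,
    Function.comp_apply]
  abel

variable [CompleteSpace E]

lemma eventually_chernForm_left (X ξ : E) : (fun p => chernForm m p (X, 0) ξ)
    =ᶠ[𝓝 0] fun p => -mixedDeriv m p X ((webQ m p).inverse ξ) := by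
  have hinvertible : ∀ᶠ p in 𝓝 0, webP m p ∈ Set.range ((↑) : (E ≃L[ℝ] E) → E →L[ℝ] E) :=
    hm.hasFDerivAt_webP.continuousAt.eventually
      (hm.webP_zero ▸ (ContinuousLinearEquiv.refl ℝ E).nhds)
  filter_upwards [hinvertible, hm.contDiffAt.eventually (by simp)] with p ⟨e, he⟩ hp
  have hp₂ : ContDiffAt ℝ 2 (uncurry m) p := hp.of_le (by norm_num)
  simp [chernForm, chernGamma, ← he, mixedDeriv_eq_secondFDeriv hp₂, ← Prod.zero_eq_mk]

lemma eventually_chernForm_right (Y ξ : E) : (fun p => chernForm m p (0, Y) ξ)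
    =ᶠ[𝓝 0] fun p => -mixedDeriv m p ((webP m p).inverse ξ) Y := by
  have hinvertible : ∀ᶠ p in 𝓝 0, webQ m p ∈ Set.range ((↑) : (E ≃L[ℝ] E) → E →L[ℝ] E) :=
    hm.hasFDerivAt_webQ.continuousAt.eventually
      (hm.webQ_zero ▸ (ContinuousLinearEquiv.refl ℝ E).nhds)
  filter_upwards [hinvertible, hm.contDiffAt.eventually (by simp)] with p ⟨e, he⟩ hp
  have hp₂ : ContDiffAt ℝ 2 (uncurry m) p := hp.of_le (by norm_num)
  simp [chernForm, chernGamma, ← he, mixedDeriv_eq_secondFDeriv hp₂, ← Prod.zero_eq_mk]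

lemma hasFDerivAt_webP_inverse (ξ : E) : HasFDerivAt (fun p => (webP m p).inverse ξ)
    (-(crossHessian m ξ ∘L .snd ℝ E E)) 0 := by
  refine (hasFDerivAt_inverse_apply (.refl ℝ E) hm.hasFDerivAt_webP hm.webP_zero
    (hasFDerivAt_const ξ 0)).congr_fderiv (ContinuousLinearMap.ext fun p => ?_)
  simp [hm.secondFDeriv_zero]

lemma hasFDerivAt_webQ_inverse (ξ : E) : HasFDerivAt (fun p => (webQ m p).inverse ξ)
    (-((crossHessian m).flip ξ ∘L .fst ℝ E E)) 0 := by
  refine (hasFDerivAt_inverse_apply (.refl ℝ E) hm.hasFDerivAt_webQ hm.webQ_zero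
    (hasFDerivAt_const ξ 0)).congr_fderiv (ContinuousLinearMap.ext fun p => ?_)
  simp [hm.secondFDeriv_zero]

lemma fderiv_chernTorsion (ξ η X Y : E) :
    fderiv ℝ (fun q => chernTorsion m q ξ η) 0 (X, Y) = -((1 / 2 : ℝ) •
      ((thirdFDeriv (uncurry m) 0 (X, Y) (ξ, 0) (0, η)
          - crossHessian m (crossHessian m ξ Y) η - crossHessian m ξ (crossHessian m X η))
        - (thirdFDeriv (uncurry m) 0 (X, Y) (η, 0) (0, ξ)
          - crossHessian m (crossHessian m η Y) ξ
          - crossHessian m η (crossHessian m X ξ)))) := by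
  have hterm (ξ η : E) :=
    hm.hasFDerivAt_mixedDeriv (hm.hasFDerivAt_webP_inverse ξ) (hm.hasFDerivAt_webQ_inverse η)
  have hderiv : HasFDerivAt (fun q => chernTorsion m q ξ η) _ 0 :=
    (((hterm ξ η).sub (hterm η ξ)).const_smul (1 / 2 : ℝ)).neg
  rw [hderiv.fderiv]
  simp [hm.webP_zero, hm.webQ_zero, sub_eq_add_neg]

lemma fderiv_chernForm_left (X ξ Y : E) :
    fderiv ℝ (fun q => chernForm m q (X, 0) ξ) 0 (0, Y) =
      -thirdFDeriv (uncurry m) 0 (0, Y) (X, 0) (0, ξ) := by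
  rw [((hm.hasFDerivAt_mixedDeriv (hasFDerivAt_const X 0)
    (hm.hasFDerivAt_webQ_inverse ξ)).neg.congr_of_eventuallyEq
    (hm.eventually_chernForm_left X ξ)).fderiv]
  simp [hm.webQ_zero]

lemma fderiv_chernForm_right (X ξ Y : E) :
    fderiv ℝ (fun q => chernForm m q (0, Y) ξ) 0 (X, 0) =
      -thirdFDeriv (uncurry m) 0 (X, 0) (ξ, 0) (0, Y) := by
  rw [((hm.hasFDerivAt_mixedDeriv (hm.hasFDerivAt_webP_inverse ξ)
    (hasFDerivAt_const Y 0)).neg.congr_of_eventuallyEq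
    (hm.eventually_chernForm_right Y ξ)).fderiv]
  simp [hm.webP_zero]

lemma chernCurvature_zero (ξ η ζ : E) : chernCurvature m 0 ξ η ζ =
    -thirdFDeriv (uncurry m) 0 (η, 0) (ξ, 0) (0, ζ)
      + thirdFDeriv (uncurry m) 0 (0, ζ) (η, 0) (0, ξ)
      + crossHessian m η (crossHessian m ξ ζ) - crossHessian m (crossHessian m η ξ) ζ := by
  simp [chernCurvature, chernCurvatureForm, hm.webP_zero, hm.webQ_zero, hm.fderiv_chernForm_left,
    hm.fderiv_chernForm_right, hm.chernForm_zero]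

lemma nablaTwoTorsion_zero (ξ η ζ : E) : nablaTwoTorsion m 0 ξ η ζ = (1 / 2 : ℝ) •
    (thirdFDeriv (uncurry m) 0 (0, ζ) (η, 0) (0, ξ)
      - thirdFDeriv (uncurry m) 0 (0, ζ) (ξ, 0) (0, η)
      + crossHessian m (crossHessian m ξ η) ζ - crossHessian m (crossHessian m η ξ) ζ
      + crossHessian m η (crossHessian m ξ ζ) - crossHessian m ξ (crossHessian m η ζ)) := by
  simp only [nablaTwoTorsion, covDerivTorsion, hm.webQ_zero, ContinuousLinearMap.inverse_id,
    ContinuousLinearMap.id_apply, hm.fderiv_chernTorsion, hm.chernForm_zero, hm.chernTorsion_zero,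
    map_neg, map_sub, map_smul, map_zero, neg_apply, sub_apply, smul_apply, zero_apply]
  module

lemma nablaOneTorsion_zero (ξ η ζ : E) : nablaOneTorsion m 0 ξ η ζ = (1 / 2 : ℝ) •
    (thirdFDeriv (uncurry m) 0 (ζ, 0) (η, 0) (0, ξ)
      - thirdFDeriv (uncurry m) 0 (ζ, 0) (ξ, 0) (0, η)
      + crossHessian m ζ (crossHessian m ξ η) - crossHessian m ζ (crossHessian m η ξ)
      - crossHessian m (crossHessian m ζ ξ) η + crossHessian m (crossHessian m ζ η) ξ) := by
  simp only [nablaOneTorsion, covDerivTorsion, hm.webP_zero, ContinuousLinearMap.inverse_id,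
    ContinuousLinearMap.id_apply, hm.fderiv_chernTorsion, hm.chernForm_zero, hm.chernTorsion_zero,
    map_neg, map_sub, map_smul, map_zero, neg_apply, sub_apply]
  module

lemma nablaTwoTorsion_zero_eq_chernCurvature (ξ η ζ : E) : nablaTwoTorsion m 0 ξ η ζ
    = (1 / 2 : ℝ) • (chernCurvature m 0 ξ η ζ - chernCurvature m 0 η ξ ζ) := by
  rw [hm.nablaTwoTorsion_zero, hm.chernCurvature_zero, hm.chernCurvature_zero,
    thirdFDeriv_left_comm hm.contDiffAt (η, 0) (ξ, 0)]
  module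

lemma nablaOneTorsion_zero_eq_chernCurvature (ξ η ζ : E) : nablaOneTorsion m 0 ξ η ζ
    = (1 / 2 : ℝ) • (chernCurvature m 0 ξ ζ η - chernCurvature m 0 η ζ ξ) := by
  rw [hm.nablaOneTorsion_zero, hm.chernCurvature_zero, hm.chernCurvature_zero,
    thirdFDeriv_left_comm hm.contDiffAt (0, η) (ζ, 0),
    thirdFDeriv_right_comm hm.contDiffAt (ζ, 0) (0, η),
    thirdFDeriv_left_comm hm.contDiffAt (ζ, 0) (0, ξ),
    thirdFDeriv_right_comm hm.contDiffAt (0, ξ) (ζ, 0),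
    thirdFDeriv_left_comm hm.contDiffAt (0, ξ) (0, η)]
  module

end IsLocalLoop

end NeutralWeb

section LocalAction

variable {E E' F W G : Type*} [NormedAddCommGroup E] [NormedSpace ℝ E]
  [NormedAddCommGroup E'] [NormedSpace ℝ E'] [NormedAddCommGroup F] [NormedSpace ℝ F]
  [NormedAddCommGroup W] [NormedSpace ℝ W] [NormedAddCommGroup G] [NormedSpace ℝ G]

lemma thirdFDeriv_comp_first_argument {f : E → E' → F} {g : F → W → G}
    (hf : ContDiffAt ℝ 3 (uncurry f) 0) (hg : ContDiffAt ℝ 3 (uncurry g) 0)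
    (hf₀ : uncurry f 0 = 0) (a : E) (b : E') (y : W) :
    thirdFDeriv (fun p : E × E' × W => g (f p.1 p.2.1) p.2.2) 0 (a, 0) (0, b, 0) (0, 0, y)
      = thirdFDeriv (uncurry g) 0 (fderiv ℝ (uncurry f) 0 (a, 0), 0)
          (fderiv ℝ (uncurry f) 0 (0, b), 0) (0, y)
        + secondFDeriv (uncurry g) 0 (secondFDeriv (uncurry f) 0 (a, 0) (0, b), 0) (0, y) := by
  let pair : E × E' × W →L[ℝ] E × E' := (ContinuousLinearMap.id ℝ E).prodMap (.fst ℝ E' W)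
  let last : E × E' × W →L[ℝ] W := .snd ℝ E' W ∘L .snd ℝ E (E' × W)
  have hpair : pair 0 = 0 := map_zero pair
  have hfst : ContDiffAt ℝ 3 (uncurry f ∘ pair) 0 :=
    contDiffAt_comp_of_eq hf pair.contDiff.contDiffAt hpair
  have hsnd : ContDiffAt ℝ 3 last 0 := last.contDiff.contDiffAt
  have hzero : ((uncurry f ∘ pair) 0, last 0) = 0 := Prod.ext hf₀ rfl
  have hfst₂ : ContDiffAt ℝ 2 (uncurry f ∘ pair) 0 := hfst.of_le (by norm_num)
  have hsnd₂ : ContDiffAt ℝ 2 last 0 := hsnd.of_le (by norm_num)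
  have hchain := thirdFDeriv_comp hg (hfst.prodMk hsnd) hzero (a, 0) (0, b, 0) (0, 0, y)
  simp only [fderiv_prodMk_apply (hfst.differentiableAt three_ne_zero)
      (hsnd.differentiableAt three_ne_zero), secondFDeriv_prodMk hfst₂ hsnd₂,
    thirdFDeriv_prodMk hfst hsnd, secondFDeriv_comp_clm pair (hf.of_le (by norm_num)) hpair,
    thirdFDeriv_comp_clm pair hf hpair, secondFDeriv_clm, thirdFDeriv_clm,
    fderiv_comp_apply (hf.differentiableAt three_ne_zero) pair.differentiableAt hpair,
    ContinuousLinearMap.fderiv] at hchain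
  have heq : (fun p : E × E' × W => g (f p.1 p.2.1) p.2.2)
      = uncurry g ∘ fun p => ((uncurry f ∘ pair) p, last p) := rfl
  rw [heq, hchain]
  simp [pair, last, ← Prod.zero_eq_mk]

lemma thirdFDeriv_comp_second_argument {f : E' → W → F} {g : E → F → G}
    (hf : ContDiffAt ℝ 3 (uncurry f) 0) (hg : ContDiffAt ℝ 3 (uncurry g) 0)
    (hf₀ : uncurry f 0 = 0) (a : E) (b : E') (y : W) :
    thirdFDeriv (fun p : E × E' × W => g p.1 (f p.2.1 p.2.2)) 0 (a, 0) (0, b, 0) (0, 0, y)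
      = thirdFDeriv (uncurry g) 0 (a, 0) (0, fderiv ℝ (uncurry f) 0 (b, 0))
          (0, fderiv ℝ (uncurry f) 0 (0, y))
        + secondFDeriv (uncurry g) 0 (a, 0) (0, secondFDeriv (uncurry f) 0 (b, 0) (0, y)) := by
  let first : E × E' × W →L[ℝ] E := .fst ℝ E (E' × W)
  let pair : E × E' × W →L[ℝ] E' × W := .snd ℝ E (E' × W)
  have hpair : pair 0 = 0 := map_zero pair
  have hfst : ContDiffAt ℝ 3 first 0 := first.contDiff.contDiffAt
  have hsnd : ContDiffAt ℝ 3 (uncurry f ∘ pair) 0 :=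
    contDiffAt_comp_of_eq hf pair.contDiff.contDiffAt hpair
  have hzero : (first 0, (uncurry f ∘ pair) 0) = 0 := Prod.ext rfl hf₀
  have hfst₂ : ContDiffAt ℝ 2 first 0 := hfst.of_le (by norm_num)
  have hsnd₂ : ContDiffAt ℝ 2 (uncurry f ∘ pair) 0 := hsnd.of_le (by norm_num)
  have hchain := thirdFDeriv_comp hg (hfst.prodMk hsnd) hzero (a, 0) (0, b, 0) (0, 0, y)
  simp only [fderiv_prodMk_apply (hfst.differentiableAt three_ne_zero)
      (hsnd.differentiableAt three_ne_zero), secondFDeriv_prodMk hfst₂ hsnd₂,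
    thirdFDeriv_prodMk hfst hsnd, secondFDeriv_comp_clm pair (hf.of_le (by norm_num)) hpair,
    thirdFDeriv_comp_clm pair hf hpair, secondFDeriv_clm, thirdFDeriv_clm,
    fderiv_comp_apply (hf.differentiableAt three_ne_zero) pair.differentiableAt hpair,
    ContinuousLinearMap.fderiv] at hchain
  have heq : (fun p : E × E' × W => g p.1 (f p.2.1 p.2.2))
      = uncurry g ∘ fun p => (first p, (uncurry f ∘ pair) p) := rfl
  rw [heq, hchain]
  simp [pair, first, ← Prod.zero_eq_mk]

lemma IsLocalLoop.thirdFDeriv_action {m : E → E → E} (hm : IsLocalLoop m) {A : E → W → W}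
    (hA : ContDiffAt ℝ 3 (uncurry A) 0) (hA_zero : ∀ᶠ y in 𝓝 (0 : W), A 0 y = y)
    (hA_mul : ∀ᶠ p in 𝓝 (0 : E × E × W), A (m p.1 p.2.1) p.2.2 = A p.1 (A p.2.1 p.2.2))
    (a b : E) (y : W) :
    thirdFDeriv (uncurry A) 0 (a, 0) (b, 0) (0, y) + crossHessian A (crossHessian m a b) y
      = thirdFDeriv (uncurry A) 0 (a, 0) (0, fderiv ℝ (uncurry A) 0 (b, 0)) (0, y)
        + crossHessian A a (crossHessian A b y) := by
  have hA₂ : ContDiffAt ℝ 2 (uncurry A) 0 := hA.of_le (by norm_num)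
  have hA_axis : fderiv ℝ (uncurry A) 0 (0, y) = y := by
    have hid : A 0 =ᶠ[𝓝 0] id := hA_zero
    have hright := fderiv_partial_right (p := (0 : E × W)) (hA.differentiableAt three_ne_zero)
    rw [Prod.fst_zero, Prod.snd_zero, hid.fderiv_eq, fderiv_id] at hright
    exact congr($(hright.symm) y)
  have hthird := congr($(thirdFDeriv_congr hA_mul) (a, 0) (0, b, 0) (0, 0, y))
  rw [thirdFDeriv_comp_first_argument hm.contDiffAt hA hm.uncurry_zero,
    thirdFDeriv_comp_second_argument hA hA hA_zero.self_of_nhds, hA_axis, hm.fderiv_zero] at hthird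
  simpa [crossHessian_apply hA₂, crossHessian_apply hm.contDiffAt_two] using hthird

end LocalAction

namespace IsLocalLoop

variable {E X : Type*} [NormedAddCommGroup E] [NormedSpace ℝ E] [NormedAddCommGroup X]
  [NormedSpace ℝ X] {m : E → E → E} (hm : IsLocalLoop m) {f g : X → E} {x : X}
include hm

lemma contDiffAt_mul (hf : ContDiffAt ℝ 3 f x) (hg : ContDiffAt ℝ 3 g x) (hf₀ : f x = 0)
    (hg₀ : g x = 0) : ContDiffAt ℝ 3 (fun z => m (f z) (g z)) x :=
  contDiffAt_comp_of_eq hm.contDiffAt (hf.prodMk hg) (Prod.ext hf₀ hg₀)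

lemma fderiv_mul (hf : DifferentiableAt ℝ f x) (hg : DifferentiableAt ℝ g x) (hf₀ : f x = 0)
    (hg₀ : g x = 0) : fderiv ℝ (fun z => m (f z) (g z)) x = fderiv ℝ f x + fderiv ℝ g x := by
  ext1 v
  have hchain := fderiv_comp_apply hm.differentiableAt (hf.prodMk hg) (Prod.ext hf₀ hg₀) v
  rwa [hm.fderiv_zero, fderiv_prodMk_apply hf hg] at hchain

lemma secondFDeriv_mul (hf : ContDiffAt ℝ 2 f x) (hg : ContDiffAt ℝ 2 g x) (hf₀ : f x = 0)
    (hg₀ : g x = 0) (v w : X) : secondFDeriv (fun z => m (f z) (g z)) x v w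
      = crossHessian m (fderiv ℝ f x v) (fderiv ℝ g x w)
        + crossHessian m (fderiv ℝ f x w) (fderiv ℝ g x v)
        + secondFDeriv f x v w + secondFDeriv g x v w := by
  have hchain := secondFDeriv_comp hm.contDiffAt_two (hf.prodMk hg) (Prod.ext hf₀ hg₀) v w
  rw [hm.fderiv_zero, hm.secondFDeriv_zero, secondFDeriv_prodMk hf hg,
    fderiv_prodMk_apply (hf.differentiableAt two_ne_zero) (hg.differentiableAt two_ne_zero),
    fderiv_prodMk_apply (hf.differentiableAt two_ne_zero) (hg.differentiableAt two_ne_zero)]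
    at hchain
  exact hchain.trans (add_assoc _ _ _).symm

end IsLocalLoop

namespace LocalLieGroup

variable {𝔤 : Type*} [NormedAddCommGroup 𝔤] [NormedSpace ℝ 𝔤] (G : LocalLieGroup 𝔤)

lemma isLocalLoop : IsLocalLoop G.mul where
  contDiffAt := G.smooth_mul.self_of_nhds.of_le (WithTop.coe_le_coe.2 le_top)
  right_neutral := G.mul_one
  left_neutral := G.one_mul

lemma contDiffAt_inv : ContDiffAt ℝ 3 G.inv 0 :=
  G.smooth_inv.self_of_nhds.of_le (WithTop.coe_le_coe.2 le_top)

lemma fderiv_inv : fderiv ℝ G.inv 0 = -.id ℝ 𝔤 := by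
  have hone : (fun x => G.mul (id x) (G.inv x)) =ᶠ[𝓝 0] fun _ => 0 := G.mul_inv
  have hmul := G.isLocalLoop.fderiv_mul differentiableAt_id
    (G.contDiffAt_inv.differentiableAt three_ne_zero) rfl G.inv_zero
  rw [hone.fderiv_eq, fderiv_fun_const, fderiv_id] at hmul
  exact eq_neg_of_add_eq_zero_right hmul.symm

/-- The Lie bracket as a continuous bilinear map: the antisymmetrised second order part of the
multiplication. -/
noncomputable def bracketL : 𝔤 →L[ℝ] 𝔤 →L[ℝ] 𝔤 :=
  crossHessian G.mul - (crossHessian G.mul).flip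

lemma bracketL_apply (x y : 𝔤) :
    G.bracketL x y = crossHessian G.mul x y - crossHessian G.mul y x := rfl

lemma bracket_eq_bracketL (x y : 𝔤) : G.bracket x y = G.bracketL x y := by
  have hvalue (x : 𝔤) : G.leftInvariantField x 0 = x := congr($(G.isLocalLoop.webQ_zero) x)
  have hderiv (x v : 𝔤) : fderiv ℝ (G.leftInvariantField x) 0 v = crossHessian G.mul v x := by
    have hfield : HasFDerivAt (G.leftInvariantField x) _ 0 :=
      (hasFDerivAt_crossHessian G.isLocalLoop.contDiffAt_two).clm_apply (hasFDerivAt_const x 0)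
    simp [hfield.fderiv]
  rw [bracket, VectorField.lieBracket, hvalue, hvalue, hderiv, hderiv, bracketL_apply]

lemma bracketL_swap (x y : 𝔤) : G.bracketL x y = -G.bracketL y x :=
  (neg_sub _ _).symm

lemma bracketL_jacobi (x y z : 𝔤) : G.bracketL (G.bracketL x y) z
    = G.bracketL (G.bracketL x z) y - G.bracketL (G.bracketL y z) x := by
  have hassoc (a b c : 𝔤) := G.isLocalLoop.thirdFDeriv_action G.isLocalLoop.contDiffAt G.one_mul
    G.mul_assoc a b c
  simp only [G.isLocalLoop.fderiv_zero, add_apply, ContinuousLinearMap.coe_fst',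
    ContinuousLinearMap.coe_snd', add_zero] at hassoc
  have hleft (a b c : 𝔤) := thirdFDeriv_left_comm G.isLocalLoop.contDiffAt (a, 0) (b, 0) (0, c)
  have hright (a b c : 𝔤) := thirdFDeriv_right_comm G.isLocalLoop.contDiffAt (a, 0) (0, b) (0, c)
  simp only [bracketL_apply, map_sub, sub_apply]
  -- The third derivatives cancel in the alternating sum of the associativity relations, since each
  -- of them is symmetric in two of its arguments.
  linear_combination (norm := module) hassoc x y z + hassoc y z x + hassoc z x y
    - hassoc y x z - hassoc x z y - hassoc z y x
    - hleft x y z - hleft y z x - hleft z x y + hright x y z + hright y z x + hright z x y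

lemma IsNormal.crossHessian_self {G : LocalLieGroup 𝔤} (hG : G.IsNormal) (x : 𝔤) :
    crossHessian G.mul x x = 0 := by
  have hsmall : ∀ᶠ x in 𝓝 (0 : 𝔤), crossHessian G.mul x x = 0 := by
    filter_upwards [hG] with x hx
    let line : ℝ →L[ℝ] 𝔤 := .toSpanSingleton ℝ x
    have hadd : uncurry G.mul ∘ line.prodMap line
        =ᶠ[𝓝 0] line ∘L (.fst ℝ ℝ ℝ + .snd ℝ ℝ ℝ) := by
      have hIcc : Set.Icc (-1 : ℝ) 1 ∈ 𝓝 (0 : ℝ) := Icc_mem_nhds (by norm_num) (by norm_num)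
      filter_upwards [prod_mem_nhds hIcc hIcc] with p hp
      exact hx _ hp.1 _ hp.2
    have hsecond := secondFDeriv_comp_clm (line.prodMap line) G.isLocalLoop.contDiffAt_two
      (map_zero _) (1, 0) (0, 1)
    rw [secondFDeriv_congr hadd, secondFDeriv_clm] at hsecond
    simpa [line, crossHessian_apply G.isLocalLoop.contDiffAt_two] using hsecond.symm
  have hline : Tendsto (fun t : ℝ => t • x) (𝓝[≠] 0) (𝓝 0) :=
    (Continuous.tendsto' (by fun_prop) 0 0 (zero_smul ℝ x)).mono_left nhdsWithin_le_nhds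
  obtain ⟨t, hzero, ht⟩ := ((hline.eventually hsmall).and self_mem_nhdsWithin).exists
  simpa [show t ≠ 0 from ht] using hzero

lemma IsNormal.crossHessian_mul {G : LocalLieGroup 𝔤} (hG : G.IsNormal) (x y : 𝔤) :
    crossHessian G.mul x y = (1 / 2 : ℝ) • G.bracketL x y := by
  have hpolar := hG.crossHessian_self (x + y)
  simp only [map_add, add_apply, hG.crossHessian_self, zero_add, add_zero] at hpolar
  rw [bracketL_apply, eq_neg_of_add_eq_zero_right hpolar]
  module

end LocalLieGroup

namespace IsLocalLoop

variable {E X Y : Type*} [NormedAddCommGroup E] [NormedSpace ℝ E] [NormedAddCommGroup X]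
  [NormedSpace ℝ X] [NormedAddCommGroup Y] [NormedSpace ℝ Y] {m : E → E → E}
  (hm : IsLocalLoop m) {f : X → E} {g : Y → E} {x : X} {y : Y}
include hm

lemma contDiffAt_mul_prodMap (hf : ContDiffAt ℝ 3 f x) (hg : ContDiffAt ℝ 3 g y) (hf₀ : f x = 0)
    (hg₀ : g y = 0) : ContDiffAt ℝ 3 (fun p : X × Y => m (f p.1) (g p.2)) (x, y) :=
  hm.contDiffAt_mul (contDiffAt_comp_of_eq hf contDiffAt_fst rfl)
    (contDiffAt_comp_of_eq hg contDiffAt_snd rfl) hf₀ hg₀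

lemma fderiv_mul_prodMap (hf : DifferentiableAt ℝ f x) (hg : DifferentiableAt ℝ g y)
    (hf₀ : f x = 0) (hg₀ : g y = 0) : fderiv ℝ (fun p : X × Y => m (f p.1) (g p.2)) (x, y)
      = (fderiv ℝ f x).coprod (fderiv ℝ g y) := by
  have hfst : HasFDerivAt (fun p : X × Y => f p.1) _ (x, y) :=
    hf.hasFDerivAt.comp (x, y) hasFDerivAt_fst
  have hsnd : HasFDerivAt (fun p : X × Y => g p.2) _ (x, y) :=
    hg.hasFDerivAt.comp (x, y) hasFDerivAt_snd
  rw [hm.fderiv_mul hfst.differentiableAt hsnd.differentiableAt hf₀ hg₀, hfst.fderiv, hsnd.fderiv]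
  rfl

lemma secondFDeriv_mul_prodMap (hf : ContDiffAt ℝ 2 f x) (hg : ContDiffAt ℝ 2 g y) (hf₀ : f x = 0)
    (hg₀ : g y = 0) (p q : X × Y) : secondFDeriv (fun p : X × Y => m (f p.1) (g p.2)) (x, y) p q
      = crossHessian m (fderiv ℝ f x p.1) (fderiv ℝ g y q.2)
        + crossHessian m (fderiv ℝ f x q.1) (fderiv ℝ g y p.2)
        + secondFDeriv f x p.1 q.1 + secondFDeriv g y p.2 q.2 := by
  have hfst : ContDiffAt ℝ 2 (fun p : X × Y => f p.1) (x, y) :=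
    contDiffAt_comp_of_eq hf contDiffAt_fst rfl
  have hsnd : ContDiffAt ℝ 2 (fun p : X × Y => g p.2) (x, y) :=
    contDiffAt_comp_of_eq hg contDiffAt_snd rfl
  have hfst₁ (v : X × Y) : fderiv ℝ (fun p : X × Y => f p.1) (x, y) v = fderiv ℝ f x v.1 :=
    fderiv_comp_apply (hf.differentiableAt two_ne_zero) differentiableAt_fst rfl v |>.trans
      (by rw [fderiv_fst]; rfl)
  have hsnd₁ (v : X × Y) : fderiv ℝ (fun p : X × Y => g p.2) (x, y) v = fderiv ℝ g y v.2 :=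
    fderiv_comp_apply (hg.differentiableAt two_ne_zero) differentiableAt_snd rfl v |>.trans
      (by rw [fderiv_snd]; rfl)
  have hfst₂ : secondFDeriv (fun p : X × Y => f p.1) (x, y) p q = secondFDeriv f x p.1 q.1 :=
    secondFDeriv_comp_clm (.fst ℝ X Y) hf rfl p q
  have hsnd₂ : secondFDeriv (fun p : X × Y => g p.2) (x, y) p q = secondFDeriv g y p.2 q.2 :=
    secondFDeriv_comp_clm (.snd ℝ X Y) hg rfl p q
  rw [hm.secondFDeriv_mul hfst hsnd hf₀ hg₀, hfst₁, hfst₁, hsnd₁, hsnd₁, hfst₂, hsnd₂]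

end IsLocalLoop

namespace LocalLieGroup

variable {𝔤 : Type*} [NormedAddCommGroup 𝔤] [NormedSpace ℝ 𝔤] (G : LocalLieGroup 𝔤)
  {V 𝔥 : Submodule ℝ 𝔤}

lemma mul_zero_zero : G.mul 0 0 = 0 :=
  G.isLocalLoop.uncurry_zero

lemma tendsto_mul {X : Type*} {l : Filter X} {f g : X → 𝔤} (hf : Tendsto f l (𝓝 0))
    (hg : Tendsto g l (𝓝 0)) : Tendsto (fun z => G.mul (f z) (g z)) l (𝓝 0) := by
  have hmul := G.isLocalLoop.contDiffAt.continuousAt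
  rw [ContinuousAt, G.isLocalLoop.uncurry_zero] at hmul
  exact hmul.comp (hf.prodMk_nhds hg)

/-- Two parametrised submanifolds `s` and `k` through the identity whose tangent spaces are
complementary: the equivalence `e` is the resulting splitting of the Lie algebra. -/
structure IsTransversal (s : V → 𝔤) (k : 𝔥 → 𝔤) (e : (V × 𝔥) ≃L[ℝ] 𝔤) : Prop where
  contDiffAt_left : ContDiffAt ℝ 3 s 0
  contDiffAt_right : ContDiffAt ℝ 3 k 0
  left_zero : s 0 = 0
  right_zero : k 0 = 0
  coe_eq : (e : V × 𝔥 →L[ℝ] 𝔤) = (fderiv ℝ s 0).coprod (fderiv ℝ k 0)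

/-- The chart `(x, h) ↦ s x · k h` of the group attached to two transversal submanifolds. -/
def cosetChart (s : V → 𝔤) (k : 𝔥 → 𝔤) (p : V × 𝔥) : 𝔤 := G.mul (s p.1) (k p.2)

/-- The action `(a, y) ↦ Π (a · s y)` of the group on the section parametrised by `s`, induced by
the left action on the cosets of the subgroup parametrised by `k`. -/
noncomputable def cosetAction (s : V → 𝔤) (k : 𝔥 → 𝔤) (a : 𝔤) (y : V) : V :=
  G.cosetProj s k (G.mul a (s y))

namespace IsTransversal

variable {s : V → 𝔤} {k : 𝔥 → 𝔤} {e : (V × 𝔥) ≃L[ℝ] 𝔤} (hT : IsTransversal s k e)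
include hT

lemma symm_fderiv_left (y : V) : e.symm (fderiv ℝ s 0 y) = (y, 0) := by
  rw [e.symm_apply_eq, ← e.coe_coe, hT.coe_eq]
  simp

lemma tendsto_left : Tendsto s (𝓝 0) (𝓝 0) := by
  simpa only [ContinuousAt, hT.left_zero] using hT.contDiffAt_left.continuousAt

lemma cosetChart_zero : G.cosetChart s k 0 = 0 := by
  rw [cosetChart, Prod.fst_zero, Prod.snd_zero, hT.left_zero, hT.right_zero,
    G.mul_zero_zero]

lemma contDiffAt_cosetChart : ContDiffAt ℝ 3 (G.cosetChart s k) 0 :=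
  G.isLocalLoop.contDiffAt_mul_prodMap hT.contDiffAt_left hT.contDiffAt_right hT.left_zero
    hT.right_zero

lemma hasFDerivAt_cosetChart : HasFDerivAt (G.cosetChart s k) (e : V × 𝔥 →L[ℝ] 𝔤) 0 := by
  rw [hT.coe_eq, ← G.isLocalLoop.fderiv_mul_prodMap
    (hT.contDiffAt_left.differentiableAt three_ne_zero)
    (hT.contDiffAt_right.differentiableAt three_ne_zero) hT.left_zero hT.right_zero]
  exact ((hT.contDiffAt_cosetChart G).differentiableAt three_ne_zero).hasFDerivAt

variable [CompleteSpace 𝔤]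

lemma exists_localInverse : ∃ Ψ : 𝔤 → V × 𝔥, ContDiffAt ℝ 3 Ψ 0 ∧ Ψ 0 = 0 ∧
    (∀ᶠ p in 𝓝 0, Ψ (G.cosetChart s k p) = p) ∧ ∀ᶠ g in 𝓝 0, G.cosetChart s k (Ψ g) = g := by
  have : CompleteSpace (V × 𝔥) :=
    (completeSpace_congr (e := e.toEquiv) e.isUniformEmbedding).2 inferInstance
  have hcont := hT.contDiffAt_cosetChart G
  have hderiv := hT.hasFDerivAt_cosetChart G
  have hstrict := hcont.hasStrictFDerivAt' hderiv three_ne_zero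
  have hzero := hT.cosetChart_zero G
  refine ⟨hcont.localInverse hderiv three_ne_zero, ?_, ?_, hstrict.eventually_left_inverse, ?_⟩
  · exact hzero ▸ hcont.to_localInverse hderiv three_ne_zero
  · simpa only [hzero] using hcont.localInverse_apply_image hderiv three_ne_zero
  · exact hzero ▸ hstrict.eventually_right_inverse

lemma cosetProj_cosetChart : G.cosetProj s k ∘ G.cosetChart s k =ᶠ[𝓝 0] Prod.fst := by
  obtain ⟨Ψ, -, -, hleft, -⟩ := hT.exists_localInverse G
  exact Classical.epsilon_spec (p := fun π : 𝔤 → V => ∀ᶠ p in 𝓝 (0 : V × 𝔥),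
    π (G.mul (s p.1) (k p.2)) = p.1) ⟨fun g => (Ψ g).1, hleft.mono fun _ => congrArg Prod.fst⟩

lemma exists_factorization : ∃ Ψ : 𝔤 → V × 𝔥, ContDiffAt ℝ 3 Ψ 0 ∧ Ψ 0 = 0 ∧
    (∀ᶠ g in 𝓝 0, G.cosetChart s k (Ψ g) = g) ∧ G.cosetProj s k =ᶠ[𝓝 0] fun g => (Ψ g).1 := by
  obtain ⟨Ψ, hΨ, hΨ_zero, -, hright⟩ := hT.exists_localInverse G
  have htendsto : Tendsto Ψ (𝓝 0) (𝓝 0) := by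
    simpa only [ContinuousAt, hΨ_zero] using hΨ.continuousAt
  refine ⟨Ψ, hΨ, hΨ_zero, hright, ?_⟩
  filter_upwards [hright, htendsto.eventually (hT.cosetProj_cosetChart G)] with g hg hproj
  rwa [Function.comp_apply, hg] at hproj

lemma contDiffAt_cosetProj : ContDiffAt ℝ 3 (G.cosetProj s k) 0 := by
  obtain ⟨Ψ, hΨ, -, -, hproj⟩ := hT.exists_factorization G
  exact (contDiffAt_fst.comp 0 hΨ).congr_of_eventuallyEq hproj

lemma cosetProj_left : ∀ᶠ x in 𝓝 (0 : V), G.cosetProj s k (s x) = x := by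
  have hline : ContinuousAt (fun x : V => (x, (0 : 𝔥))) 0 := by fun_prop
  filter_upwards [hline.eventually (hT.cosetProj_cosetChart G),
    hT.tendsto_left.eventually G.mul_one] with x hx hone
  simpa only [Function.comp_apply, cosetChart, hT.right_zero, hone] using hx

lemma fderiv_cosetProj (w : 𝔤) : fderiv ℝ (G.cosetProj s k) 0 w = (e.symm w).1 := by
  have hchain := fderiv_comp_apply ((hT.contDiffAt_cosetProj G).differentiableAt three_ne_zero)
    (hT.hasFDerivAt_cosetChart G).differentiableAt (hT.cosetChart_zero G) (e.symm w)
  rw [(hT.cosetProj_cosetChart G).fderiv_eq, fderiv_fst, (hT.hasFDerivAt_cosetChart G).fderiv]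
    at hchain
  simpa using hchain.symm

lemma secondFDeriv_cosetProj (v w : 𝔤) : secondFDeriv (G.cosetProj s k) 0 v w
    = -(e.symm (secondFDeriv (G.cosetChart s k) 0 (e.symm v) (e.symm w))).1 := by
  have hchain := secondFDeriv_comp ((hT.contDiffAt_cosetProj G).of_le (by norm_num))
    ((hT.contDiffAt_cosetChart G).of_le (by norm_num)) (hT.cosetChart_zero G) (e.symm v) (e.symm w)
  have hfst : secondFDeriv (Prod.fst : V × 𝔥 → V) = 0 := secondFDeriv_clm (.fst ℝ V 𝔥)
  rw [secondFDeriv_congr (hT.cosetProj_cosetChart G), hfst, (hT.hasFDerivAt_cosetChart G).fderiv,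
    hT.fderiv_cosetProj] at hchain
  simpa using eq_neg_of_add_eq_zero_left hchain.symm

lemma contDiffAt_cosetAction : ContDiffAt ℝ 3 (uncurry (G.cosetAction s k)) 0 :=
  contDiffAt_comp_of_eq (hT.contDiffAt_cosetProj G)
    (G.isLocalLoop.contDiffAt_mul_prodMap contDiffAt_id hT.contDiffAt_left rfl hT.left_zero)
    (by simp [hT.left_zero, G.mul_zero_zero])

lemma cosetAction_zero_left : ∀ᶠ y in 𝓝 (0 : V), G.cosetAction s k 0 y = y := by
  filter_upwards [hT.cosetProj_left G, hT.tendsto_left.eventually G.one_mul] with y hy hone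
  rw [cosetAction, hone, hy]

lemma fderiv_cosetAction_inl (a : 𝔤) :
    fderiv ℝ (uncurry (G.cosetAction s k)) 0 (a, 0) = (e.symm a).1 := by
  have hpartial := fderiv_partial_left (p := (0 : 𝔤 × V))
    ((hT.contDiffAt_cosetAction G).differentiableAt three_ne_zero)
  have hproj : (fun a => G.cosetAction s k a 0) =ᶠ[𝓝 0] G.cosetProj s k := by
    filter_upwards [G.mul_one] with a hone
    rw [cosetAction, hT.left_zero, hone]
  rw [Prod.fst_zero, Prod.snd_zero, hproj.fderiv_eq] at hpartial
  rw [← hT.fderiv_cosetProj G, hpartial, ContinuousLinearMap.comp_apply,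
    ContinuousLinearMap.inl_apply]

lemma crossHessian_cosetAction (a : 𝔤) (y : V) : crossHessian (G.cosetAction s k) a y
    = (e.symm (crossHessian G.mul a (fderiv ℝ s 0 y)
        - crossHessian G.mul (fderiv ℝ s 0 y) (fderiv ℝ k 0 (e.symm a).2)
        - secondFDeriv s 0 (e.symm a).1 y)).1 := by
  have hs : ContDiffAt ℝ 2 s 0 := hT.contDiffAt_left.of_le (by norm_num)
  have hk : ContDiffAt ℝ 2 k 0 := hT.contDiffAt_right.of_le (by norm_num)
  have hinner : ContDiffAt ℝ 2 (fun p : 𝔤 × V => G.mul (id p.1) (s p.2)) 0 :=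
    (G.isLocalLoop.contDiffAt_mul_prodMap contDiffAt_id hT.contDiffAt_left rfl hT.left_zero).of_le
      (by norm_num)
  have hinner₁ : fderiv ℝ (fun p : 𝔤 × V => G.mul (id p.1) (s p.2)) 0
      = (fderiv ℝ id 0).coprod (fderiv ℝ s 0) :=
    G.isLocalLoop.fderiv_mul_prodMap differentiableAt_id (hs.differentiableAt two_ne_zero) rfl
      hT.left_zero
  have hinner₂ : secondFDeriv (fun p : 𝔤 × V => G.mul (id p.1) (s p.2)) 0 (a, 0) (0, y) = _ :=
    G.isLocalLoop.secondFDeriv_mul_prodMap contDiffAt_id hs rfl hT.left_zero (a, 0) (0, y)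
  have hchart₂ : secondFDeriv (G.cosetChart s k) 0 (e.symm a) (y, 0) = _ :=
    G.isLocalLoop.secondFDeriv_mul_prodMap hs hk hT.left_zero hT.right_zero (e.symm a) (y, 0)
  have hchain := secondFDeriv_comp ((hT.contDiffAt_cosetProj G).of_le (by norm_num)) hinner
    (by simp [hT.left_zero, G.mul_zero_zero]) (a, 0) (0, y)
  rw [hinner₁, hinner₂, hT.fderiv_cosetProj, hT.secondFDeriv_cosetProj] at hchain
  simp only [ContinuousLinearMap.coprod_apply, map_zero, add_zero, zero_add, fderiv_id,
    ContinuousLinearMap.id_apply, zero_apply, hT.symm_fderiv_left, hchart₂] at hchain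
  rw [crossHessian_apply ((hT.contDiffAt_cosetAction G).of_le (by norm_num))]
  refine hchain.trans ?_
  simp only [map_add, map_sub, Prod.fst_add, Prod.fst_sub]
  abel

lemma isLocalLoop : IsLocalLoop (G.cosetLoop s k) where
  contDiffAt := contDiffAt_comp_of_eq (hT.contDiffAt_cosetProj G)
    (G.isLocalLoop.contDiffAt_mul_prodMap hT.contDiffAt_left hT.contDiffAt_left hT.left_zero
      hT.left_zero) (by simp [hT.left_zero, G.mul_zero_zero])
  left_neutral := by
    filter_upwards [hT.cosetAction_zero_left G] with y hy
    rwa [cosetLoop, hT.left_zero]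
  right_neutral := by
    filter_upwards [hT.cosetProj_left G, hT.tendsto_left.eventually G.mul_one] with x hx hone
    rw [cosetLoop, hT.left_zero, hone, hx]

end IsTransversal

end LocalLieGroup

section Reparametrization

variable {E F W X : Type*} [NormedAddCommGroup E] [NormedSpace ℝ E] [NormedAddCommGroup F]
  [NormedSpace ℝ F] [NormedAddCommGroup W] [NormedSpace ℝ W] [NormedAddCommGroup X]
  [NormedSpace ℝ X] {f : E → W → F} {s : X → E}

lemma crossHessian_comp_left (hf : ContDiffAt ℝ 2 (uncurry f) 0) (hs : DifferentiableAt ℝ s 0)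
    (hs₀ : s 0 = 0) (x : X) (y : W) :
    crossHessian (fun x => f (s x)) x y = crossHessian f (fderiv ℝ s 0 x) y := by
  have hpartial := hasFDerivAt_crossHessian hf
  rw [← hs₀] at hpartial
  exact congr($((hpartial.comp 0 hs.hasFDerivAt).fderiv) x y)

lemma thirdFDeriv_comp_left (hf : ContDiffAt ℝ 3 (uncurry f) 0) (hs : ContDiffAt ℝ 3 s 0)
    (hs₀ : s 0 = 0) (p q r : X × W) : thirdFDeriv (uncurry fun x => f (s x)) 0 p q r
      = thirdFDeriv (uncurry f) 0 (fderiv ℝ s 0 p.1, p.2) (fderiv ℝ s 0 q.1, q.2)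
          (fderiv ℝ s 0 r.1, r.2)
        + secondFDeriv (uncurry f) 0 (secondFDeriv s 0 p.1 q.1, 0) (fderiv ℝ s 0 r.1, r.2)
        + secondFDeriv (uncurry f) 0 (fderiv ℝ s 0 q.1, q.2) (secondFDeriv s 0 p.1 r.1, 0)
        + secondFDeriv (uncurry f) 0 (fderiv ℝ s 0 p.1, p.2) (secondFDeriv s 0 q.1 r.1, 0)
        + fderiv ℝ (uncurry f) 0 (thirdFDeriv s 0 p.1 q.1 r.1, 0) := by
  let fst : X × W →L[ℝ] X := .fst ℝ X W
  let snd : X × W →L[ℝ] W := .snd ℝ X W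
  have hfst : ContDiffAt ℝ 3 (s ∘ fst) 0 := contDiffAt_comp_of_eq hs fst.contDiff.contDiffAt rfl
  have hsnd : ContDiffAt ℝ 3 snd 0 := snd.contDiff.contDiffAt
  have hfst₁ (v : X × W) : fderiv ℝ (s ∘ fst) 0 v = fderiv ℝ s 0 v.1 := by
    rw [fderiv_comp_apply (hs.differentiableAt three_ne_zero) fst.differentiableAt rfl, fst.fderiv]
    rfl
  have hchain := thirdFDeriv_comp hf (hfst.prodMk hsnd) (Prod.ext hs₀ rfl) p q r
  simp only [fderiv_prodMk_apply (hfst.differentiableAt three_ne_zero) snd.differentiableAt,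
    secondFDeriv_prodMk (hfst.of_le (by norm_num)) (hsnd.of_le (by norm_num)),
    thirdFDeriv_prodMk hfst hsnd, secondFDeriv_comp_clm fst (hs.of_le (by norm_num)) (map_zero fst),
    thirdFDeriv_comp_clm fst hs (map_zero fst), secondFDeriv_clm, thirdFDeriv_clm, snd.fderiv,
    hfst₁, Pi.zero_apply, zero_apply] at hchain
  exact hchain

end Reparametrization

namespace LocalLieGroup.IsTransversal

variable {𝔤 : Type*} [NormedAddCommGroup 𝔤] [NormedSpace ℝ 𝔤] [CompleteSpace 𝔤]
  (G : LocalLieGroup 𝔤) {V 𝔥 : Submodule ℝ 𝔤} {s : V → 𝔤} {k : 𝔥 → 𝔤} {e : (V × 𝔥) ≃L[ℝ] 𝔤}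
  (hT : IsTransversal s k e)
include hT

lemma crossHessian_cosetLoop (ξ η : V) : crossHessian (G.cosetLoop s k) ξ η
    = crossHessian (G.cosetAction s k) (fderiv ℝ s 0 ξ) η :=
  crossHessian_comp_left ((hT.contDiffAt_cosetAction G).of_le (by norm_num))
    (hT.contDiffAt_left.differentiableAt three_ne_zero) hT.left_zero ξ η

lemma chernTorsion_cosetLoop (ξ η : V) : chernTorsion (G.cosetLoop s k) 0 ξ η
    = -((1 / 2 : ℝ) • (e.symm (G.bracketL (fderiv ℝ s 0 ξ) (fderiv ℝ s 0 η))).1) := by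
  rw [(hT.isLocalLoop G).chernTorsion_zero, hT.crossHessian_cosetLoop, hT.crossHessian_cosetLoop,
    hT.crossHessian_cosetAction, hT.crossHessian_cosetAction, hT.symm_fderiv_left,
    hT.symm_fderiv_left, secondFDeriv_comm (hT.contDiffAt_left.of_le (by norm_num)) η,
    G.bracketL_apply]
  simp

lemma thirdFDeriv_cosetLoop_left (ξ η ζ : V) :
    thirdFDeriv (uncurry (G.cosetLoop s k)) 0 (ξ, 0) (η, 0) (0, ζ)
      = thirdFDeriv (uncurry (G.cosetAction s k)) 0 (fderiv ℝ s 0 ξ, 0) (fderiv ℝ s 0 η, 0) (0, ζ)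
        + crossHessian (G.cosetAction s k) (secondFDeriv s 0 ξ η) ζ := by
  have hA := hT.contDiffAt_cosetAction G
  have hchain : thirdFDeriv (uncurry (G.cosetLoop s k)) 0 (ξ, 0) (η, 0) (0, ζ) = _ :=
    thirdFDeriv_comp_left hA hT.contDiffAt_left hT.left_zero (ξ, 0) (η, 0) (0, ζ)
  simpa [crossHessian_apply (hA.of_le (by norm_num)), ← Prod.zero_eq_mk] using hchain

lemma thirdFDeriv_cosetLoop_right (ξ η ζ : V) :
    thirdFDeriv (uncurry (G.cosetLoop s k)) 0 (ξ, 0) (0, η) (0, ζ)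
      = thirdFDeriv (uncurry (G.cosetAction s k)) 0 (fderiv ℝ s 0 ξ, 0) (0, η) (0, ζ) := by
  have hchain : thirdFDeriv (uncurry (G.cosetLoop s k)) 0 (ξ, 0) (0, η) (0, ζ) = _ :=
    thirdFDeriv_comp_left (hT.contDiffAt_cosetAction G) hT.contDiffAt_left hT.left_zero
      (ξ, 0) (0, η) (0, ζ)
  simpa [← Prod.zero_eq_mk] using hchain

end LocalLieGroup.IsTransversal

namespace LocalLieGroup.IsTransversal

variable {𝔤 : Type*} [NormedAddCommGroup 𝔤] [NormedSpace ℝ 𝔤] [CompleteSpace 𝔤]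
  {G : LocalLieGroup 𝔤} {V 𝔥 : Submodule ℝ 𝔤} {s : V → 𝔤} {e : (V × 𝔥) ≃L[ℝ] 𝔤}
  (hT : IsTransversal s ((↑) : 𝔥 → 𝔤) e)
include hT

lemma cosetProj_mul_of_mem : ∀ᶠ p in 𝓝 (0 : V × 𝔤),
    p.2 ∈ 𝔥 → G.cosetProj s ((↑) : 𝔥 → 𝔤) (G.mul (s p.1) p.2) = p.1 := by
  have hind : IsInducing (Prod.map id (↑) : V × 𝔥 → V × 𝔤) := .prodMap .id .subtypeVal
  have hchart := hT.cosetProj_cosetChart G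
  rw [EventuallyEq, hind.nhds_eq_comap, eventually_comap] at hchart
  filter_upwards [hchart] with p hp hmem
  exact hp (p.1, ⟨p.2, hmem⟩) rfl

variable (h𝔥 : G.IsLocalSubgroup 𝔥)
include h𝔥

lemma cosetProj_mul_right : ∀ᶠ p in 𝓝 (0 : 𝔤 × 𝔥),
    G.cosetProj s ((↑) : 𝔥 → 𝔤) (G.mul p.1 p.2) = G.cosetProj s ((↑) : 𝔥 → 𝔤) p.1 := by
  obtain ⟨Ψ, hΨ, hΨ_zero, hfactor, hproj⟩ := hT.exists_factorization G
  have hg : Tendsto (fun p : 𝔤 × 𝔥 => p.1) (𝓝 0) (𝓝 0) := continuous_fst.tendsto 0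
  have hh : Tendsto (fun p : 𝔤 × 𝔥 => p.2) (𝓝 0) (𝓝 0) := continuous_snd.tendsto 0
  have hcoe : Tendsto ((↑) : 𝔥 → 𝔤) (𝓝 0) (𝓝 0) := 𝔥.subtypeL.continuous.tendsto' 0 0 rfl
  have hΨg : Tendsto (fun p : 𝔤 × 𝔥 => Ψ p.1) (𝓝 0) (𝓝 0) :=
    Tendsto.comp (hΨ_zero ▸ hΨ.continuousAt.tendsto) hg
  have hx : Tendsto (fun p : 𝔤 × 𝔥 => (Ψ p.1).1) (𝓝 0) (𝓝 0) :=
    (continuous_fst.tendsto (0 : V × 𝔥)).comp hΨg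
  have hh' : Tendsto (fun p : 𝔤 × 𝔥 => (Ψ p.1).2) (𝓝 0) (𝓝 0) :=
    (continuous_snd.tendsto (0 : V × 𝔥)).comp hΨg
  have hmul := G.tendsto_mul (hcoe.comp hh') (hcoe.comp hh)
  filter_upwards [hg.eventually hfactor, hg.eventually hproj, ((hT.tendsto_left.comp hx).prodMk_nhds
      ((hcoe.comp hh').prodMk_nhds (hcoe.comp hh))).eventually G.mul_assoc,
    (hh'.prodMk_nhds hh).eventually h𝔥, (hx.prodMk_nhds hmul).eventually hT.cosetProj_mul_of_mem]
    with p hsplit hπ hassoc hmem hcoset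
  calc G.cosetProj s ((↑) : 𝔥 → 𝔤) (G.mul p.1 p.2)
      = G.cosetProj s ((↑) : 𝔥 → 𝔤) (G.mul (G.mul (s (Ψ p.1).1) (Ψ p.1).2) p.2) :=
        congr(G.cosetProj s ((↑) : 𝔥 → 𝔤) (G.mul $(hsplit.symm) p.2))
    _ = G.cosetProj s ((↑) : 𝔥 → 𝔤) (G.mul (s (Ψ p.1).1) (G.mul (Ψ p.1).2 p.2)) :=
        congrArg (G.cosetProj s ((↑) : 𝔥 → 𝔤)) hassoc
    _ = (Ψ p.1).1 := hcoset hmem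
    _ = G.cosetProj s ((↑) : 𝔥 → 𝔤) p.1 := hπ.symm

lemma cosetProj_mul_cosetProj : ∀ᶠ p in 𝓝 (0 : 𝔤 × 𝔤), G.cosetProj s ((↑) : 𝔥 → 𝔤) (G.mul p.1 p.2)
    = G.cosetProj s ((↑) : 𝔥 → 𝔤) (G.mul p.1 (s (G.cosetProj s ((↑) : 𝔥 → 𝔤) p.2))) := by
  obtain ⟨Ψ, hΨ, hΨ_zero, hfactor, hproj⟩ := hT.exists_factorization G
  have ha : Tendsto (fun p : 𝔤 × 𝔤 => p.1) (𝓝 0) (𝓝 0) := continuous_fst.tendsto 0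
  have hg : Tendsto (fun p : 𝔤 × 𝔤 => p.2) (𝓝 0) (𝓝 0) := continuous_snd.tendsto 0
  have hcoe : Tendsto ((↑) : 𝔥 → 𝔤) (𝓝 0) (𝓝 0) := 𝔥.subtypeL.continuous.tendsto' 0 0 rfl
  have hΨg : Tendsto (fun p : 𝔤 × 𝔤 => Ψ p.2) (𝓝 0) (𝓝 0) :=
    Tendsto.comp (hΨ_zero ▸ hΨ.continuousAt.tendsto) hg
  have hx : Tendsto (fun p : 𝔤 × 𝔤 => s (Ψ p.2).1) (𝓝 0) (𝓝 0) :=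
    hT.tendsto_left.comp ((continuous_fst.tendsto (0 : V × 𝔥)).comp hΨg)
  have hh : Tendsto (fun p : 𝔤 × 𝔤 => (Ψ p.2).2) (𝓝 0) (𝓝 0) :=
    (continuous_snd.tendsto (0 : V × 𝔥)).comp hΨg
  filter_upwards [hg.eventually hfactor, hg.eventually hproj,
    (ha.prodMk_nhds (hx.prodMk_nhds (hcoe.comp hh))).eventually G.mul_assoc,
    ((G.tendsto_mul ha hx).prodMk_nhds hh).eventually (hT.cosetProj_mul_right h𝔥)]
    with p hsplit hπ hassoc hcoset
  calc G.cosetProj s ((↑) : 𝔥 → 𝔤) (G.mul p.1 p.2)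
      = G.cosetProj s ((↑) : 𝔥 → 𝔤) (G.mul p.1 (G.mul (s (Ψ p.2).1) (Ψ p.2).2)) :=
        congr(G.cosetProj s ((↑) : 𝔥 → 𝔤) (G.mul p.1 $(hsplit.symm)))
    _ = G.cosetProj s ((↑) : 𝔥 → 𝔤) (G.mul (G.mul p.1 (s (Ψ p.2).1)) (Ψ p.2).2) :=
        congrArg (G.cosetProj s ((↑) : 𝔥 → 𝔤)) hassoc.symm
    _ = G.cosetProj s ((↑) : 𝔥 → 𝔤) (G.mul p.1 (s (Ψ p.2).1)) := hcoset
    _ = G.cosetProj s ((↑) : 𝔥 → 𝔤) (G.mul p.1 (s (G.cosetProj s ((↑) : 𝔥 → 𝔤) p.2))) := by rw [hπ]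

lemma cosetAction_mul : ∀ᶠ p in 𝓝 (0 : 𝔤 × 𝔤 × V),
    G.cosetAction s ((↑) : 𝔥 → 𝔤) (G.mul p.1 p.2.1) p.2.2
      = G.cosetAction s ((↑) : 𝔥 → 𝔤) p.1 (G.cosetAction s ((↑) : 𝔥 → 𝔤) p.2.1 p.2.2) := by
  have ha : Tendsto (fun p : 𝔤 × 𝔤 × V => p.1) (𝓝 0) (𝓝 0) := continuous_fst.tendsto 0
  have hb : Tendsto (fun p : 𝔤 × 𝔤 × V => p.2.1) (𝓝 0) (𝓝 0) :=
    Continuous.tendsto (by fun_prop) 0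
  have hy : Tendsto (fun p : 𝔤 × 𝔤 × V => s p.2.2) (𝓝 0) (𝓝 0) :=
    hT.tendsto_left.comp (Continuous.tendsto (by fun_prop) 0)
  filter_upwards [(ha.prodMk_nhds (hb.prodMk_nhds hy)).eventually G.mul_assoc,
    (ha.prodMk_nhds (G.tendsto_mul hb hy)).eventually (hT.cosetProj_mul_cosetProj h𝔥)]
    with p hassoc hproj
  exact (congrArg (G.cosetProj s ((↑) : 𝔥 → 𝔤)) hassoc).trans hproj

end LocalLieGroup.IsTransversal

lemma coe_projectionOntoL_symm {𝔤 : Type*} [NormedAddCommGroup 𝔤] [NormedSpace ℝ 𝔤]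
    {V 𝔥 : Submodule ℝ 𝔤} (hV : V.IsTopCompl 𝔥) (w : 𝔤) :
    (𝔥.projectionOntoL V hV.symm w : 𝔤) = w - V.projectionOntoL 𝔥 hV w :=
  Submodule.projectionL_eq_self_sub_projectionL hV w

section SectionMap

variable {𝔤 : Type*} [NormedAddCommGroup 𝔤] [NormedSpace ℝ 𝔤] {V 𝔥 : Submodule ℝ 𝔤} {φ : V → 𝔥}

lemma sectionMap_zero (hφ₀ : φ 0 = 0) : sectionMap φ 0 = 0 := by simp [sectionMap, hφ₀]

lemma contDiffAt_sectionMap {n : WithTop ℕ∞} {ξ : V} (hφ : ContDiffAt ℝ n φ ξ) :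
    ContDiffAt ℝ n (sectionMap φ) ξ :=
  V.subtypeL.contDiff.contDiffAt.add (𝔥.subtypeL.contDiff.contDiffAt.comp ξ hφ)

lemma tendsto_sectionMap (hφ : ContinuousAt φ 0) (hφ₀ : φ 0 = 0) :
    Tendsto (sectionMap φ) (𝓝 0) (𝓝 0) :=
  (by simp [hφ₀] : (0 : 𝔤) + φ 0 = 0) ▸
    V.subtypeL.continuous.continuousAt.add (𝔥.subtypeL.continuous.continuousAt.comp hφ)

lemma hasFDerivAt_sectionMap (hφ : DifferentiableAt ℝ φ 0) (hφ₁ : fderiv ℝ φ 0 = 0) :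
    HasFDerivAt (sectionMap φ) V.subtypeL 0 := by
  have hφ' : HasFDerivAt φ (0 : V →L[ℝ] 𝔥) 0 := hφ₁ ▸ hφ.hasFDerivAt
  exact (V.subtypeL.hasFDerivAt.add (𝔥.subtypeL.hasFDerivAt.comp (0 : V) hφ')).congr_fderiv
    (by simp)

lemma secondFDeriv_sectionMap (hφ : ContDiffAt ℝ 2 φ 0) (ξ η : V) :
    secondFDeriv (sectionMap φ) 0 ξ η = (2 : ℝ) • (quadraticPart φ ξ η : 𝔤) := by
  have hid : ContDiffAt ℝ 2 (fun ξ : V => ξ) 0 := contDiffAt_id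
  have hid₂ : secondFDeriv (fun ξ : V => ξ) 0 = 0 := congr($(secondFDeriv_clm (.id ℝ V)) 0)
  have hsplit : secondFDeriv (sectionMap φ) 0 ξ η = _ :=
    secondFDeriv_clm_comp (V.subtypeL.coprod 𝔥.subtypeL) (hid.prodMk hφ) ξ η
  rw [hsplit, secondFDeriv_prodMk hid hφ, hid₂]
  simp [quadraticPart, secondFDeriv]

lemma quadraticPart_comm (hφ : ContDiffAt ℝ 2 φ 0) (ξ η : V) :
    quadraticPart φ ξ η = quadraticPart φ η ξ :=
  congrArg _ (secondFDeriv_comm hφ ξ η)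

end SectionMap

namespace LocalLieGroup

variable {𝔤 : Type*} [NormedAddCommGroup 𝔤] [NormedSpace ℝ 𝔤]
  {G : LocalLieGroup 𝔤} {V 𝔥 : Submodule ℝ 𝔤} {φ : V → 𝔥} (hV : V.IsTopCompl 𝔥)
  (hφ : ContDiffAt ℝ 3 φ 0) (hφ₀ : φ 0 = 0) (hφ₁ : fderiv ℝ φ 0 = 0)
include hV hφ hφ₀ hφ₁

lemma isTransversal_sectionMap : IsTransversal (sectionMap φ) ((↑) : 𝔥 → 𝔤)
    (V.prodEquivOfIsTopCompl 𝔥 hV) where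
  contDiffAt_left := contDiffAt_sectionMap hφ
  contDiffAt_right := 𝔥.subtypeL.contDiff.contDiffAt
  left_zero := sectionMap_zero hφ₀
  right_zero := rfl
  coe_eq := by
    rw [(hasFDerivAt_sectionMap (hφ.differentiableAt three_ne_zero) hφ₁).fderiv,
      show fderiv ℝ ((↑) : 𝔥 → 𝔤) 0 = 𝔥.subtypeL from 𝔥.subtypeL.fderiv]
    rfl

variable [CompleteSpace 𝔤]

lemma isLocalLoop_sectionLoop : IsLocalLoop (G.sectionLoop φ) :=
  (isTransversal_sectionMap hV hφ hφ₀ hφ₁).isLocalLoop G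

lemma crossHessian_sectionAction (hG : G.IsNormal) (a : 𝔤) (y : V) :
    crossHessian (G.cosetAction (sectionMap φ) ((↑) : 𝔥 → 𝔤)) a y
      = V.projectionOntoL 𝔥 hV (G.bracketL a y)
        - (1 / 2 : ℝ) • V.projectionOntoL 𝔥 hV (G.bracketL (V.projectionOntoL 𝔥 hV a) y) := by
  have hT := isTransversal_sectionMap hV hφ hφ₀ hφ₁
  have hs' := (hasFDerivAt_sectionMap (hφ.differentiableAt three_ne_zero) hφ₁).fderiv
  have hcoe : fderiv ℝ ((↑) : 𝔥 → 𝔤) 0 = 𝔥.subtypeL := 𝔥.subtypeL.fderiv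
  rw [hT.crossHessian_cosetAction, hs', hcoe,
    secondFDeriv_sectionMap (hφ.of_le (by norm_num)), hG.crossHessian_mul, hG.crossHessian_mul,
    Submodule.prodEquivOfIsTopCompl_symm_apply, Submodule.prodEquivOfIsTopCompl_symm_apply,
    𝔥.subtypeL_apply, coe_projectionOntoL_symm hV, G.bracketL_swap _ (a - _)]
  simp only [Submodule.subtypeL_apply, map_sub, map_smul, map_neg, sub_apply,
    Submodule.projectionOntoL_apply_right]
  module

lemma crossHessian_sectionLoop (hG : G.IsNormal) (ξ η : V) :
    crossHessian (G.sectionLoop φ) ξ η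
      = (1 / 2 : ℝ) • V.projectionOntoL 𝔥 hV (G.bracketL ξ η) := by
  rw [sectionLoop, (isTransversal_sectionMap hV hφ hφ₀ hφ₁).crossHessian_cosetLoop,
    crossHessian_sectionAction hV hφ hφ₀ hφ₁ hG,
    (hasFDerivAt_sectionMap (hφ.differentiableAt three_ne_zero) hφ₁).fderiv,
    Submodule.subtypeL_apply, Submodule.projectionOntoL_apply_left]
  module

lemma thirdFDeriv_sectionAction (h𝔥 : G.IsLocalSubgroup 𝔥) (a b : 𝔤) (y : V) :
    letI A := G.cosetAction (sectionMap φ) ((↑) : 𝔥 → 𝔤)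
    thirdFDeriv (uncurry A) 0 (a, 0) (b, 0) (0, y)
      = thirdFDeriv (uncurry A) 0 (a, 0) (0, V.projectionOntoL 𝔥 hV b) (0, y)
        + crossHessian A a (crossHessian A b y) - crossHessian A (crossHessian G.mul a b) y := by
  have hT := isTransversal_sectionMap hV hφ hφ₀ hφ₁
  have haction := G.isLocalLoop.thirdFDeriv_action (hT.contDiffAt_cosetAction G)
    (hT.cosetAction_zero_left G) (hT.cosetAction_mul h𝔥) a b y
  rw [hT.fderiv_cosetAction_inl, Submodule.prodEquivOfIsTopCompl_symm_apply] at haction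
  exact eq_sub_of_add_eq haction

theorem nablaTwoTorsion_sectionLoop (hG : G.IsNormal) (h𝔥 : G.IsLocalSubgroup 𝔥) (ξ η ζ : V) :
    letI pr := V.projectionOntoL 𝔥 hV
    nablaTwoTorsion (G.sectionLoop φ) 0 ξ η ζ
      = -((1 / 2 : ℝ) • pr (G.bracketL (G.bracketL ξ η) ζ))
        + (1 / 2 : ℝ) • pr (G.bracketL (pr (G.bracketL ξ η)) ζ) := by
  have : CompleteSpace V := hV.isClosed.completeSpace_coe
  have hT := isTransversal_sectionMap hV hφ hφ₀ hφ₁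
  have hL := isLocalLoop_sectionLoop (G := G) hV hφ hφ₀ hφ₁
  have hs' := (hasFDerivAt_sectionMap (hφ.differentiableAt three_ne_zero) hφ₁).fderiv
  have hloop (ξ η : V) : thirdFDeriv (uncurry (G.sectionLoop φ)) 0 (0, ζ) (η, 0) (0, ξ)
      = thirdFDeriv (uncurry (G.cosetAction (sectionMap φ) ((↑) : 𝔥 → 𝔤))) 0
          ((η : 𝔤), 0) (0, ξ) (0, ζ) := by
    rw [thirdFDeriv_left_comm hL.contDiffAt, thirdFDeriv_right_comm hL.contDiffAt]
    exact (hT.thirdFDeriv_cosetLoop_right G η ξ ζ).trans (by rw [hs', Submodule.subtypeL_apply])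
  have hηξ := thirdFDeriv_sectionAction hV hφ hφ₀ hφ₁ h𝔥 (η : 𝔤) (ξ : 𝔤) ζ
  have hξη := thirdFDeriv_sectionAction hV hφ hφ₀ hφ₁ h𝔥 (ξ : 𝔤) (η : 𝔤) ζ
  rw [thirdFDeriv_left_comm (hT.contDiffAt_cosetAction G), hξη] at hηξ
  simp only [Submodule.projectionOntoL_apply_left, crossHessian_sectionAction hV hφ hφ₀ hφ₁ hG,
    hG.crossHessian_mul, map_smul, map_sub, smul_apply, Submodule.coe_sub, Submodule.coe_smul,
    G.bracketL_swap (η : 𝔤) ξ, map_neg, neg_apply] at hηξ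
  rw [hL.nablaTwoTorsion_zero, hloop, hloop]
  simp only [crossHessian_sectionLoop hV hφ hφ₀ hφ₁ hG, map_smul, smul_apply, Submodule.coe_smul,
    G.bracketL_swap (η : 𝔤) ξ, map_neg, neg_apply]
  linear_combination (norm := module) -((1 / 2 : ℝ) • hηξ)

theorem nablaOneTorsion_sectionLoop (hG : G.IsNormal) (h𝔥 : G.IsLocalSubgroup 𝔥) (ξ η ζ : V) :
    letI pr := V.projectionOntoL 𝔥 hV
    nablaOneTorsion (G.sectionLoop φ) 0 ξ η ζ
      = -((1 / 4 : ℝ) • pr (G.bracketL (G.bracketL ξ ζ) η))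
        + (1 / 4 : ℝ) • pr (G.bracketL (pr (G.bracketL ξ ζ)) η)
        - pr (G.bracketL (quadraticPart φ ξ ζ) η)
        + (1 / 4 : ℝ) • pr (G.bracketL (G.bracketL η ζ) ξ)
        - (1 / 4 : ℝ) • pr (G.bracketL (pr (G.bracketL η ζ)) ξ)
        + pr (G.bracketL (quadraticPart φ η ζ) ξ) := by
  have : CompleteSpace V := hV.isClosed.completeSpace_coe
  have hT := isTransversal_sectionMap hV hφ hφ₀ hφ₁
  have hL := isLocalLoop_sectionLoop (G := G) hV hφ hφ₀ hφ₁
  have hφ_two : ContDiffAt ℝ 2 φ 0 := hφ.of_le (by norm_num)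
  have hs' := (hasFDerivAt_sectionMap (hφ.differentiableAt three_ne_zero) hφ₁).fderiv
  have hloop (ξ η : V) : thirdFDeriv (uncurry (G.sectionLoop φ)) 0 (ζ, 0) (η, 0) (0, ξ)
      = thirdFDeriv (uncurry (G.cosetAction (sectionMap φ) ((↑) : 𝔥 → 𝔤))) 0
          ((ζ : 𝔤), 0) ((η : 𝔤), 0) (0, ξ)
        + crossHessian (G.cosetAction (sectionMap φ) ((↑) : 𝔥 → 𝔤))
          ((2 : ℝ) • quadraticPart φ η ζ) ξ := by
    rw [sectionLoop, hT.thirdFDeriv_cosetLoop_left, hs', secondFDeriv_sectionMap hφ_two,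
      quadraticPart_comm hφ_two]
    rfl
  rw [hL.nablaOneTorsion_zero, hloop, hloop,
    thirdFDeriv_sectionAction hV hφ hφ₀ hφ₁ h𝔥, thirdFDeriv_sectionAction hV hφ hφ₀ hφ₁ h𝔥]
  simp only [Submodule.projectionOntoL_apply_left]
  rw [thirdFDeriv_right_comm (hT.contDiffAt_cosetAction G) _ (0, η)]
  simp only [crossHessian_sectionAction hV hφ hφ₀ hφ₁ hG, crossHessian_sectionLoop hV hφ hφ₀ hφ₁ hG,
    Submodule.projectionOntoL_apply_left, Submodule.projectionOntoL_apply_right,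
    hG.crossHessian_mul, map_smul, map_sub, smul_apply, Submodule.coe_sub, Submodule.coe_smul,
    G.bracketL_swap (η : 𝔤) ξ, G.bracketL_swap (ζ : 𝔤) ξ, G.bracketL_swap (ζ : 𝔤) η, map_neg,
    neg_apply, Submodule.coe_neg, map_zero, zero_apply, Submodule.coe_zero]
  module

end LocalLieGroup

section Splittings

variable {𝔤 E F : Type*} [NormedAddCommGroup 𝔤] [NormedSpace ℝ 𝔤] [NormedAddCommGroup E]
  [NormedSpace ℝ E] [NormedAddCommGroup F] [NormedSpace ℝ F] {A : E →L[ℝ] 𝔤} {B : F →L[ℝ] 𝔤}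
  {e : (E × F) ≃L[ℝ] 𝔤} (he : (e : E × F →L[ℝ] 𝔤) = A.coprod B)
include he

lemma injective_of_equiv_eq_coprod : Function.Injective A := by
  have hA : ⇑A = e ∘ (·, 0) := by
    ext x
    simpa using congr($he.symm (x, 0))
  exact hA ▸ e.injective.comp (Prod.mk_left_injective 0)

lemma isCompl_range_of_equiv_eq_coprod :
    IsCompl (LinearMap.range A.toLinearMap) (LinearMap.range B.toLinearMap) := by
  have hA : A.toLinearMap = e.toLinearEquiv.toLinearMap ∘ₗ .inl ℝ E F := by
    ext x
    simpa using congr($he.symm (x, 0))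
  have hB : B.toLinearMap = e.toLinearEquiv.toLinearMap ∘ₗ .inr ℝ E F := by
    ext y
    simpa using congr($he.symm (0, y))
  rw [hA, hB, LinearMap.range_comp, LinearMap.range_comp]
  exact LinearMap.isCompl_range_inl_inr.map (Submodule.orderIsoMapComap e.toLinearEquiv)

lemma projAlong_range_of_equiv_eq_coprod (w : 𝔤) :
    projAlong (LinearMap.range A.toLinearMap) (LinearMap.range B.toLinearMap) w
      = A (e.symm w).1 := by
  have hcompl := isCompl_range_of_equiv_eq_coprod he
  have hsplit : w = A (e.symm w).1 + B (e.symm w).2 := by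
    rw [← A.coprod_apply, ← he, e.coe_coe, e.apply_symm_apply]
  have hA : A (e.symm w).1 ∈ LinearMap.range A.toLinearMap := ⟨_, rfl⟩
  have hB : B (e.symm w).2 ∈ LinearMap.range B.toLinearMap := ⟨_, rfl⟩
  rw [projAlong, dif_pos hcompl]
  nth_rewrite 1 [hsplit]
  rw [map_add, Submodule.projectionOnto_apply_of_mem_left hcompl hA,
    Submodule.projectionOnto_apply_of_mem_right hcompl hB, add_zero]

end Splittings

namespace LocalLieGroup

variable {𝔤 : Type*} [NormedAddCommGroup 𝔤] [NormedSpace ℝ 𝔤] (G : LocalLieGroup 𝔤)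

lemma conj_zero_right : ∀ᶠ g in 𝓝 (0 : 𝔤), G.conj g 0 = 0 := by
  filter_upwards [G.mul_one, G.mul_inv] with g hg hinv
  rw [conj, hg, hinv]

lemma contDiffAt_conj : ContDiffAt ℝ 3 (uncurry G.conj) 0 :=
  G.isLocalLoop.contDiffAt_mul G.isLocalLoop.contDiffAt
    (contDiffAt_comp_of_eq G.contDiffAt_inv contDiffAt_fst rfl) G.mul_zero_zero G.inv_zero

lemma fderiv_inv_fst :
    fderiv ℝ (fun p : 𝔤 × 𝔤 => G.inv p.1) 0 = -.fst ℝ 𝔤 𝔤 := by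
  refine ContinuousLinearMap.ext fun p => ?_
  have hchain := fderiv_comp_apply (G.contDiffAt_inv.differentiableAt three_ne_zero)
    (ContinuousLinearMap.fst ℝ 𝔤 𝔤).differentiableAt (map_zero _) p
  rwa [ContinuousLinearMap.fderiv, G.fderiv_inv] at hchain

lemma fderiv_conj : fderiv ℝ (uncurry G.conj) 0 = .snd ℝ 𝔤 𝔤 := by
  have hconj : fderiv ℝ (uncurry G.conj) 0 = _ :=
    G.isLocalLoop.fderiv_mul (f := uncurry G.mul) (g := fun p => G.inv p.1)
    G.isLocalLoop.differentiableAt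
    ((contDiffAt_comp_of_eq G.contDiffAt_inv contDiffAt_fst rfl).differentiableAt three_ne_zero)
    G.mul_zero_zero G.inv_zero
  rw [hconj, G.fderiv_inv_fst, G.isLocalLoop.fderiv_zero]
  abel

lemma crossHessian_conj : crossHessian G.conj = G.bracketL := by
  ext g h
  have hinv : ContDiffAt ℝ 2 (fun p : 𝔤 × 𝔤 => G.inv p.1) 0 :=
    contDiffAt_comp_of_eq (G.contDiffAt_inv.of_le (by norm_num)) contDiffAt_fst rfl
  have hinv₂ : secondFDeriv (fun p : 𝔤 × 𝔤 => G.inv p.1) 0 (g, 0) (0, h) = _ :=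
    secondFDeriv_comp_clm (.fst ℝ 𝔤 𝔤) (G.contDiffAt_inv.of_le (by norm_num)) (map_zero _) _ _
  have hconj : secondFDeriv (uncurry G.conj) 0 (g, 0) (0, h) = _ :=
    G.isLocalLoop.secondFDeriv_mul (f := uncurry G.mul) G.isLocalLoop.contDiffAt_two hinv
      G.mul_zero_zero G.inv_zero _ _
  rw [crossHessian_apply (G.contDiffAt_conj.of_le (by norm_num)), hconj, hinv₂,
    G.fderiv_inv_fst, G.isLocalLoop.fderiv_zero, G.isLocalLoop.secondFDeriv_zero, bracketL_apply]
  simp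
  abel

lemma Ad_zero : G.Ad 0 = .id ℝ 𝔤 := by
  have hpartial := fderiv_partial_right (f := G.conj) (p := (0 : 𝔤 × 𝔤))
    (G.contDiffAt_conj.differentiableAt three_ne_zero)
  rw [G.fderiv_conj] at hpartial
  exact hpartial

lemma hasFDerivAt_Ad : HasFDerivAt G.Ad G.bracketL 0 :=
  G.crossHessian_conj ▸ hasFDerivAt_crossHessian (G.contDiffAt_conj.of_le (by norm_num))

end LocalLieGroup

namespace LocalLieGroup

variable {𝔤 : Type*} [NormedAddCommGroup 𝔤] [NormedSpace ℝ 𝔤] (G : LocalLieGroup 𝔤)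
  {V : Submodule ℝ 𝔤} (𝔥 : Submodule ℝ 𝔤)

/-- The torsion tensor at the neutral element of the loop `(x, y) ↦ Π (x y)` on the section
parametrised by `s`, where `Π` is the projection parallel to `g H g⁻¹`, in the parameter `V`. -/
noncomputable def conjTorsion (s : V → 𝔤) (g : 𝔤) (ξ η : V) : V :=
  chernTorsion (G.cosetLoop s fun h : 𝔥 => G.conj g h) 0 ξ η

/-- The differential `V × 𝔥 → 𝔤` at the identity of the chart `(ξ, h) ↦ s ξ · g h g⁻¹`. -/
noncomputable def conjSplitting (s : V → 𝔤) (g : 𝔤) : V × 𝔥 →L[ℝ] 𝔤 :=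
  (fderiv ℝ s 0).coprod (G.Ad g ∘L 𝔥.subtypeL)

lemma map_Ad_eq_range (g : 𝔤) :
    𝔥.map (G.Ad g).toLinearMap = LinearMap.range (G.Ad g ∘L 𝔥.subtypeL).toLinearMap := by
  ext
  simp

lemma eventually_contDiffAt_conj : ∀ᶠ g in 𝓝 (0 : 𝔤), ContDiffAt ℝ 3 (uncurry G.conj) (g, 0) :=
  (Continuous.prodMk_left 0).continuousAt.eventually (G.contDiffAt_conj.eventually (by simp))

variable {G 𝔥}

lemma hasDerivAt_conjSplitting {s : ℝ → V → 𝔤} {g : ℝ → 𝔤} {S : V →L[ℝ] 𝔤} {ζ : 𝔤}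
    (hS : HasDerivAt (fun t => fderiv ℝ (s t) 0) S 0) (hg₀ : g 0 = 0) (hg : HasDerivAt g ζ 0) :
    HasDerivAt (fun t => G.conjSplitting 𝔥 (s t) (g t))
      (S.coprod (G.bracketL ζ ∘L 𝔥.subtypeL)) 0 := by
  have hAd : HasDerivAt (fun t => G.Ad (g t)) (G.bracketL ζ) 0 :=
    G.hasFDerivAt_Ad.comp_hasDerivAt_of_eq 0 hg hg₀.symm
  have hleft := hS.clm_comp (hasDerivAt_const (0 : ℝ) (ContinuousLinearMap.fst ℝ V 𝔥))
  have hright := hAd.clm_comp (hasDerivAt_const (0 : ℝ) (𝔥.subtypeL ∘L .snd ℝ V 𝔥))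
  refine ((hleft.add hright).congr_deriv ?_).congr_of_eventuallyEq (.of_forall fun t => ?_) <;>
    ext <;> simp [conjSplitting]

variable [CompleteSpace 𝔤] (hV : V.IsTopCompl 𝔥)

section Eventually

variable {X : Type*} {l : Filter X} {s : X → V → 𝔤} {g : X → 𝔤}
  (hs : ∀ᶠ x in l, ContDiffAt ℝ 3 (s x) 0) (hs₀ : ∀ᶠ x in l, s x 0 = 0)
  (hs' : Tendsto (fun x => fderiv ℝ (s x) 0) l (𝓝 V.subtypeL)) (hg : Tendsto g l (𝓝 0))
include hV hs hs₀ hs' hg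

lemma eventually_isTransversal_conj : ∀ᶠ x in l, ∃ e : (V × 𝔥) ≃L[ℝ] 𝔤,
    (e : V × 𝔥 →L[ℝ] 𝔤) = G.conjSplitting 𝔥 (s x) (g x) ∧
      IsTransversal (s x) (fun h : 𝔥 => G.conj (g x) h) e := by
  have : CompleteSpace V := hV.isClosed.completeSpace_coe
  have : CompleteSpace 𝔥 := hV.symm.isClosed.completeSpace_coe
  have hAd : Tendsto (fun x => G.Ad (g x)) l (𝓝 (.id ℝ 𝔤)) :=
    (G.Ad_zero ▸ G.hasFDerivAt_Ad.continuousAt : Tendsto G.Ad (𝓝 0) (𝓝 (.id ℝ 𝔤))).comp hg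
  have hAd𝔥 := ((𝔥.subtypeL.precomp 𝔤).continuous.tendsto _).comp hAd
  have hsplit : Tendsto (fun x => G.conjSplitting 𝔥 (s x) (g x)) l
      (𝓝 (V.prodEquivOfIsTopCompl 𝔥 hV)) :=
    ((ContinuousLinearMap.coprodEquivL (𝕜 := ℝ) (E := V) (F := 𝔥) (G := 𝔤) ℝ).continuous.tendsto
      (V.subtypeL, 𝔥.subtypeL)).comp (hs'.prodMk_nhds hAd𝔥)
  filter_upwards [hs, hs₀, hsplit.eventually (V.prodEquivOfIsTopCompl 𝔥 hV).nhds,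
    hg.eventually G.eventually_contDiffAt_conj, hg.eventually G.conj_zero_right]
    with x hsx hsx₀ ⟨e, he⟩ hconj hconj₀
  have hconj' : ContDiffAt ℝ 3 (G.conj (g x)) 0 :=
    contDiffAt_comp_of_eq hconj (contDiffAt_const.prodMk contDiffAt_id) rfl
  have hk : fderiv ℝ (fun h : 𝔥 => G.conj (g x) h) 0 = G.Ad (g x) ∘L 𝔥.subtypeL := by
    refine ContinuousLinearMap.ext fun h => ?_
    have hchain := fderiv_comp_apply (hconj'.differentiableAt three_ne_zero)
      𝔥.subtypeL.differentiableAt (map_zero _) h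
    rwa [ContinuousLinearMap.fderiv] at hchain
  exact ⟨e, he,
    { contDiffAt_left := hsx
      contDiffAt_right :=
        contDiffAt_comp_of_eq hconj' 𝔥.subtypeL.contDiff.contDiffAt rfl
      left_zero := hsx₀
      right_zero := hconj₀
      coe_eq := by rw [he, hk, conjSplitting] }⟩

lemma eventually_conjTorsion_eq_projAlong : ∀ᶠ x in l, Function.Injective (fderiv ℝ (s x) 0) ∧
    IsCompl (LinearMap.range (fderiv ℝ (s x) 0).toLinearMap) (𝔥.map (G.Ad (g x)).toLinearMap) ∧
    ∀ ξ η : V, fderiv ℝ (s x) 0 (G.conjTorsion 𝔥 (s x) (g x) ξ η)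
      = -((1 / 2 : ℝ) • projAlong (LinearMap.range (fderiv ℝ (s x) 0).toLinearMap)
          (𝔥.map (G.Ad (g x)).toLinearMap)
          (G.bracketL (fderiv ℝ (s x) 0 ξ) (fderiv ℝ (s x) 0 η))) := by
  filter_upwards [eventually_isTransversal_conj (G := G) hV hs hs₀ hs' hg] with x ⟨e, he, hT⟩
  rw [map_Ad_eq_range]
  refine ⟨injective_of_equiv_eq_coprod he, isCompl_range_of_equiv_eq_coprod he, fun ξ η => ?_⟩
  rw [conjTorsion, hT.chernTorsion_cosetLoop, projAlong_range_of_equiv_eq_coprod he, map_neg,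
    map_smul]

lemma eventually_conjTorsion_eq_inverse (ξ η : V) : ∀ᶠ x in l,
    G.conjTorsion 𝔥 (s x) (g x) ξ η
      = -((1 / 2 : ℝ) • ((G.conjSplitting 𝔥 (s x) (g x)).inverse
          (G.bracketL (fderiv ℝ (s x) 0 ξ) (fderiv ℝ (s x) 0 η))).1) := by
  filter_upwards [eventually_isTransversal_conj (G := G) hV hs hs₀ hs' hg] with x ⟨e, he, hT⟩
  rw [conjTorsion, hT.chernTorsion_cosetLoop, ← he, ContinuousLinearMap.inverse_equiv]
  rfl

end Eventually

lemma hasDerivAt_conjTorsion {s : ℝ → V → 𝔤} {g : ℝ → 𝔤} {S : V →L[ℝ] 𝔤} {ζ : 𝔤}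
    (hs : ∀ᶠ t in 𝓝 0, ContDiffAt ℝ 3 (s t) 0) (hs₀ : ∀ᶠ t in 𝓝 0, s t 0 = 0)
    (hs₁ : fderiv ℝ (s 0) 0 = V.subtypeL) (hS : HasDerivAt (fun t => fderiv ℝ (s t) 0) S 0)
    (hg₀ : g 0 = 0) (hg : HasDerivAt g ζ 0) (ξ η : V) :
    HasDerivAt (fun t => G.conjTorsion 𝔥 (s t) (g t) ξ η)
      (-((1 / 2 : ℝ) • V.projectionOntoL 𝔥 hV (G.bracketL (S ξ) η + G.bracketL ξ (S η)
        - S (V.projectionOntoL 𝔥 hV (G.bracketL ξ η))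
        - G.bracketL ζ (𝔥.projectionOntoL V hV.symm (G.bracketL ξ η))))) 0 := by
  have : CompleteSpace V := hV.isClosed.completeSpace_coe
  have : CompleteSpace 𝔥 := hV.symm.isClosed.completeSpace_coe
  let e := V.prodEquivOfIsTopCompl 𝔥 hV
  have he_symm (w : 𝔤) :
      e.symm w = (V.projectionOntoL 𝔥 hV w, 𝔥.projectionOntoL V hV.symm w) :=
    Submodule.prodEquivOfIsTopCompl_symm_apply hV w
  have hsplit := hasDerivAt_conjSplitting (G := G) (𝔥 := 𝔥) hS hg₀ hg
  have hsplit₀ : G.conjSplitting 𝔥 (s 0) (g 0) = e := by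
    rw [conjSplitting, hs₁, hg₀, G.Ad_zero]
    rfl
  have hS_apply (ξ : V) : HasDerivAt (fun t => fderiv ℝ (s t) 0 ξ) (S ξ) 0 := by
    simpa using hS.clm_apply (hasDerivAt_const (0 : ℝ) ξ)
  have hbracket : HasDerivAt
      (fun t => G.bracketL (fderiv ℝ (s t) 0 ξ) (fderiv ℝ (s t) 0 η)) _ 0 :=
    (G.bracketL.hasFDerivAt.comp_hasDerivAt 0 (hS_apply ξ)).clm_apply (hS_apply η)
  have hinverse := (hasFDerivAt_inverse_apply e hsplit.hasFDerivAt hsplit₀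
    hbracket.hasFDerivAt).hasDerivAt
  have htorsion := (((ContinuousLinearMap.fst ℝ V 𝔥).hasFDerivAt.comp_hasDerivAt 0
    hinverse).const_smul (1 / 2 : ℝ)).neg
  have hs_cont : ContinuousAt (fun t => fderiv ℝ (s t) 0) 0 :=
    HasDerivAt.continuousAt (F := V →L[ℝ] 𝔤) hS
  have hs' : Tendsto (fun t => fderiv ℝ (s t) 0) (𝓝 0) (𝓝 V.subtypeL) := hs₁ ▸ hs_cont
  have hg' : Tendsto g (𝓝 0) (𝓝 0) := by simpa only [ContinuousAt, hg₀] using hg.continuousAt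
  refine (htorsion.congr_of_eventuallyEq (eventually_conjTorsion_eq_inverse hV hs hs₀
    hs' hg' ξ η)).congr_deriv ?_
  simp [hs₁, he_symm, sub_sub]

end LocalLieGroup

namespace LocalLieGroup

variable {𝔤 : Type*} [NormedAddCommGroup 𝔤] [NormedSpace ℝ 𝔤]
  {G : LocalLieGroup 𝔤} {V 𝔥 : Submodule ℝ 𝔤} {φ : V → 𝔥}

section InvSectionMap

variable (hφ : ContDiffAt ℝ 3 φ 0) (hφ₀ : φ 0 = 0)
include hφ hφ₀

lemma contDiffAt_inv_sectionMap : ContDiffAt ℝ 3 (fun u => G.inv (sectionMap φ u)) 0 :=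
  contDiffAt_comp_of_eq G.contDiffAt_inv (contDiffAt_sectionMap hφ) (sectionMap_zero hφ₀)

lemma contDiffAt_inv_sectionMap_fst :
    ContDiffAt ℝ 3 (fun p : V × V => G.inv (sectionMap φ p.1)) 0 :=
  contDiffAt_comp_of_eq (g := fun u => G.inv (sectionMap φ u)) (contDiffAt_inv_sectionMap hφ hφ₀)
    contDiffAt_fst rfl

lemma fderiv_inv_sectionMap_fst (hφ₁ : fderiv ℝ φ 0 = 0) :
    fderiv ℝ (fun p : V × V => G.inv (sectionMap φ p.1)) 0
      = -(V.subtypeL ∘L .fst ℝ V V) := by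
  have hs := hasFDerivAt_sectionMap (hφ.differentiableAt three_ne_zero) hφ₁
  have hinv : HasFDerivAt G.inv (-.id ℝ 𝔤) (sectionMap φ 0) := by
    rw [sectionMap_zero hφ₀, ← G.fderiv_inv]
    exact (G.contDiffAt_inv.differentiableAt three_ne_zero).hasFDerivAt
  have hchain := (hinv.comp (0 : V) hs).comp (f := Prod.fst) (0 : V × V) hasFDerivAt_fst
  exact (hchain.congr_fderiv (by ext <;> simp)).fderiv

lemma secondFDeriv_inv_sectionMap_fst (p : V × V) (ξ : V) :
    secondFDeriv (fun p : V × V => G.inv (sectionMap φ p.1)) 0 p (0, ξ) = 0 := by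
  have hchain : secondFDeriv (fun p : V × V => G.inv (sectionMap φ p.1)) 0 p (0, ξ) = _ :=
    secondFDeriv_comp_clm (.fst ℝ V V)
      ((contDiffAt_inv_sectionMap hφ hφ₀).of_le (by norm_num)) (map_zero _) p (0, ξ)
  rw [hchain, ContinuousLinearMap.coe_fst', map_zero]

end InvSectionMap

variable (hV : V.IsTopCompl 𝔥) (hφ : ContDiffAt ℝ 3 φ 0) (hφ₀ : φ 0 = 0)
  (hφ₁ : fderiv ℝ φ 0 = 0) [CompleteSpace 𝔤]
include hV hφ hφ₀ hφ₁

lemma contDiffAt_sectionMap_sectionLoop :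
    ContDiffAt ℝ 3 (fun p : V × V => sectionMap φ (G.sectionLoop φ p.1 p.2)) 0 :=
  have hL := isLocalLoop_sectionLoop (G := G) hV hφ hφ₀ hφ₁
  contDiffAt_comp_of_eq (contDiffAt_sectionMap hφ) hL.contDiffAt hL.uncurry_zero

lemma sectionMap_sectionLoop_zero : sectionMap φ (G.sectionLoop φ 0 0) = 0 := by
  have hzero : G.sectionLoop φ 0 0 = 0 := (isLocalLoop_sectionLoop hV hφ hφ₀ hφ₁).uncurry_zero
  rw [hzero, sectionMap_zero hφ₀]

lemma fderiv_sectionMap_sectionLoop :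
    fderiv ℝ (fun p : V × V => sectionMap φ (G.sectionLoop φ p.1 p.2)) 0
      = V.subtypeL ∘L (.fst ℝ V V + .snd ℝ V V) := by
  have hL := isLocalLoop_sectionLoop (G := G) hV hφ hφ₀ hφ₁
  have hs := hasFDerivAt_sectionMap (hφ.differentiableAt three_ne_zero) hφ₁
  refine ContinuousLinearMap.ext fun p => ?_
  have hchain := fderiv_comp_apply hs.differentiableAt hL.differentiableAt hL.uncurry_zero p
  rwa [hs.fderiv, hL.fderiv_zero] at hchain

lemma secondFDeriv_sectionMap_sectionLoop (hG : G.IsNormal) (u ξ : V) :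
    secondFDeriv (fun p : V × V => sectionMap φ (G.sectionLoop φ p.1 p.2)) 0 (u, 0) (0, ξ)
      = (2 : ℝ) • (quadraticPart φ u ξ : 𝔤)
        + (1 / 2 : ℝ) • (V.projectionOntoL 𝔥 hV (G.bracketL u ξ) : 𝔤) := by
  have hL := isLocalLoop_sectionLoop (G := G) hV hφ hφ₀ hφ₁
  have hφ_two : ContDiffAt ℝ 2 φ 0 := hφ.of_le (by norm_num)
  have hs := hasFDerivAt_sectionMap (hφ.differentiableAt three_ne_zero) hφ₁
  have hchain : secondFDeriv (fun p : V × V => sectionMap φ (G.sectionLoop φ p.1 p.2)) 0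
      (u, 0) (0, ξ) = _ :=
    secondFDeriv_comp (contDiffAt_sectionMap hφ_two) hL.contDiffAt_two hL.uncurry_zero _ _
  rw [hchain, hs.fderiv, hL.fderiv_zero, ← crossHessian_apply hL.contDiffAt_two,
    crossHessian_sectionLoop hV hφ hφ₀ hφ₁ hG, secondFDeriv_sectionMap hφ_two]
  simp

lemma contDiffAt_psi : ContDiffAt ℝ 3 (uncurry (G.psi φ)) 0 :=
  G.isLocalLoop.contDiffAt_mul (contDiffAt_sectionMap_sectionLoop hV hφ hφ₀ hφ₁)
    (contDiffAt_inv_sectionMap_fst hφ hφ₀) (sectionMap_sectionLoop_zero hV hφ hφ₀ hφ₁)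
    (by rw [Prod.fst_zero, sectionMap_zero hφ₀, G.inv_zero])

lemma fderiv_psi : fderiv ℝ (uncurry (G.psi φ)) 0 = V.subtypeL ∘L .snd ℝ V V := by
  have hpsi : fderiv ℝ (uncurry (G.psi φ)) 0 = _ := G.isLocalLoop.fderiv_mul
    ((contDiffAt_sectionMap_sectionLoop hV hφ hφ₀ hφ₁).differentiableAt three_ne_zero)
    ((contDiffAt_inv_sectionMap_fst hφ hφ₀).differentiableAt three_ne_zero)
    (sectionMap_sectionLoop_zero hV hφ hφ₀ hφ₁)
    (by rw [Prod.fst_zero, sectionMap_zero hφ₀, G.inv_zero])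
  rw [hpsi, fderiv_sectionMap_sectionLoop hV hφ hφ₀ hφ₁, fderiv_inv_sectionMap_fst hφ hφ₀ hφ₁,
    ContinuousLinearMap.comp_add]
  abel

lemma crossHessian_psi (hG : G.IsNormal) (u ξ : V) :
    crossHessian (G.psi φ) u ξ = (1 / 2 : ℝ) • G.bracketL u ξ
      + (1 / 2 : ℝ) • (V.projectionOntoL 𝔥 hV (G.bracketL u ξ) : 𝔤)
      + (2 : ℝ) • (quadraticPart φ u ξ : 𝔤) := by
  have hpsi : secondFDeriv (uncurry (G.psi φ)) 0 (u, 0) (0, ξ) = _ :=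
    G.isLocalLoop.secondFDeriv_mul
      ((contDiffAt_sectionMap_sectionLoop hV hφ hφ₀ hφ₁).of_le (by norm_num))
      ((contDiffAt_inv_sectionMap_fst hφ hφ₀).of_le (by norm_num))
      (sectionMap_sectionLoop_zero hV hφ hφ₀ hφ₁)
      (by rw [Prod.fst_zero, sectionMap_zero hφ₀, G.inv_zero]) _ _
  rw [crossHessian_apply ((contDiffAt_psi hV hφ hφ₀ hφ₁).of_le (by norm_num)), hpsi,
    secondFDeriv_sectionMap_sectionLoop hV hφ hφ₀ hφ₁ hG, secondFDeriv_inv_sectionMap_fst hφ hφ₀,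
    fderiv_sectionMap_sectionLoop hV hφ hφ₀ hφ₁, fderiv_inv_sectionMap_fst hφ hφ₀ hφ₁]
  simp [hG.crossHessian_mul, G.bracketL_swap ξ u]
  module

lemma eventually_contDiffAt_psi : ∀ᶠ u in 𝓝 (0 : V), ContDiffAt ℝ 3 (G.psi φ u) 0 := by
  filter_upwards [(Continuous.prodMk_left (0 : V)).continuousAt.eventually
    ((contDiffAt_psi (G := G) hV hφ hφ₀ hφ₁).eventually (by simp))] with u hu
  exact contDiffAt_comp_of_eq hu (contDiffAt_const.prodMk contDiffAt_id) rfl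

lemma psi_zero_right : ∀ᶠ u in 𝓝 (0 : V), G.psi φ u 0 = 0 := by
  filter_upwards [(isLocalLoop_sectionLoop (G := G) hV hφ hφ₀ hφ₁).right_neutral,
    (tendsto_sectionMap hφ.continuousAt hφ₀).eventually G.mul_inv] with u hu hinv
  rw [psi, hu, hinv]

lemma dPsi_zero : G.dPsi φ 0 = V.subtypeL := by
  have hpartial := fderiv_partial_right (f := G.psi φ) (p := (0 : V × V))
    ((contDiffAt_psi hV hφ hφ₀ hφ₁).differentiableAt three_ne_zero)
  rw [fderiv_psi hV hφ hφ₀ hφ₁] at hpartial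
  exact hpartial

lemma hasFDerivAt_dPsi : HasFDerivAt (G.dPsi φ) (crossHessian (G.psi φ)) 0 :=
  hasFDerivAt_crossHessian ((contDiffAt_psi hV hφ hφ₀ hφ₁).of_le (by norm_num))

theorem isLittleO_dPsi (hG : G.IsNormal) (ξ : V) :
    (fun u => G.dPsi φ u ξ - ((ξ : 𝔤) + (1 / 2 : ℝ) • G.bracketL u ξ
      + (1 / 2 : ℝ) • (V.projectionOntoL 𝔥 hV (G.bracketL u ξ) : 𝔤)
      + (2 : ℝ) • (quadraticPart φ u ξ : 𝔤))) =o[𝓝 0] fun u => u := by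
  have hderiv : HasFDerivAt (fun u => G.dPsi φ u ξ) ((crossHessian (G.psi φ)).flip ξ) 0 :=
    ((hasFDerivAt_dPsi hV hφ hφ₀ hφ₁).clm_apply (hasFDerivAt_const ξ 0)).congr_fderiv (by simp)
  refine hderiv.isLittleO.congr (fun u => ?_) (sub_zero ·)
  rw [dPsi_zero hV hφ hφ₀ hφ₁, sub_zero, ContinuousLinearMap.flip_apply,
    crossHessian_psi hV hφ hφ₀ hφ₁ hG, V.subtypeL_apply]
  abel

end LocalLieGroup

namespace LocalLieGroup

variable {𝔤 : Type*} [NormedAddCommGroup 𝔤] [NormedSpace ℝ 𝔤] {G : LocalLieGroup 𝔤}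
  {V 𝔥 : Submodule ℝ 𝔤} {φ : V → 𝔥} [CompleteSpace 𝔤] (hV : V.IsTopCompl 𝔥)
  (hφ : ContDiffAt ℝ 3 φ 0) (hφ₀ : φ 0 = 0) (hφ₁ : fderiv ℝ φ 0 = 0)
include hV hφ hφ₀ hφ₁

theorem eventually_torsionTwo_eq : ∀ᶠ g in 𝓝 (0 : 𝔤), IsCompl V (𝔥.map (G.Ad g).toLinearMap) ∧
    ∀ ξ η : V, (G.torsionTwo φ g ξ η : 𝔤)
      = -((1 / 2 : ℝ) • projAlong V (𝔥.map (G.Ad g).toLinearMap) (G.bracketL ξ η)) := by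
  have hs' := (hasFDerivAt_sectionMap (hφ.differentiableAt three_ne_zero) hφ₁).fderiv
  have hrange : LinearMap.range V.subtypeL.toLinearMap = V := V.range_subtype
  have hconj := eventually_conjTorsion_eq_projAlong (G := G) (s := fun _ : 𝔤 => sectionMap φ)
    (g := id) hV (.of_forall fun _ => contDiffAt_sectionMap hφ)
    (.of_forall fun _ => sectionMap_zero hφ₀) (hs' ▸ tendsto_const_nhds) tendsto_id
  simp only [hs', hrange] at hconj
  exact hconj.mono fun g hg => hg.2

theorem eventually_torsionOne_eq : ∀ᶠ u in 𝓝 (0 : V), Function.Injective (G.dPsi φ u) ∧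
    IsCompl (LinearMap.range (G.dPsi φ u).toLinearMap)
      (𝔥.map (G.Ad (sectionMap φ u)).toLinearMap) ∧
    ∀ ξ η : V, G.dPsi φ u (G.torsionOne φ u ξ η)
      = -((1 / 2 : ℝ) • projAlong (LinearMap.range (G.dPsi φ u).toLinearMap)
          (𝔥.map (G.Ad (sectionMap φ u)).toLinearMap)
          (G.bracketL (G.dPsi φ u ξ) (G.dPsi φ u η))) := by
  have hdPsi : Tendsto (G.dPsi φ) (𝓝 0) (𝓝 V.subtypeL) :=
    dPsi_zero (G := G) hV hφ hφ₀ hφ₁ ▸ (hasFDerivAt_dPsi hV hφ hφ₀ hφ₁).continuousAt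
  exact eventually_conjTorsion_eq_projAlong hV (eventually_contDiffAt_psi hV hφ hφ₀ hφ₁)
    (psi_zero_right hV hφ hφ₀ hφ₁) hdPsi (tendsto_sectionMap hφ.continuousAt hφ₀)

theorem hasDerivAt_torsionTwo {g : ℝ → 𝔤} {ζ : 𝔤} (hg₀ : g 0 = 0) (hg : HasDerivAt g ζ 0)
    (ξ η : V) :
    letI pr := V.projectionOntoL 𝔥 hV
    HasDerivAt (fun t => G.torsionTwo φ (g t) ξ η)
      (-((1 / 2 : ℝ) • pr (G.bracketL (G.bracketL ξ η) ζ))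
        + (1 / 2 : ℝ) • pr (G.bracketL (pr (G.bracketL ξ η)) ζ)) 0 := by
  have hs' := (hasFDerivAt_sectionMap (hφ.differentiableAt three_ne_zero) hφ₁).fderiv
  have hconst : HasDerivAt (fun _ : ℝ => fderiv ℝ (sectionMap φ) 0) (0 : V →L[ℝ] 𝔤) 0 :=
    hasDerivAt_const (F := V →L[ℝ] 𝔤) (0 : ℝ) _
  refine (hasDerivAt_conjTorsion hV (.of_forall fun _ => contDiffAt_sectionMap hφ)
    (.of_forall fun _ => sectionMap_zero hφ₀) hs' hconst hg₀ hg ξ η).congr_deriv ?_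
  rw [coe_projectionOntoL_symm hV, G.bracketL_swap ζ]
  simp only [zero_apply, map_zero, add_zero, zero_sub, sub_zero, neg_neg, map_sub, sub_apply]
  module

theorem hasDerivAt_torsionOne (hG : G.IsNormal) {u : ℝ → V} {ζ : V} (hu₀ : u 0 = 0)
    (hu : HasDerivAt u ζ 0) (ξ η : V) :
    letI pr := V.projectionOntoL 𝔥 hV
    HasDerivAt (fun t => G.torsionOne φ (u t) ξ η)
      (-((1 / 4 : ℝ) • pr (G.bracketL (G.bracketL ξ ζ) η))
        + (1 / 4 : ℝ) • pr (G.bracketL (pr (G.bracketL ξ ζ)) η)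
        - pr (G.bracketL (quadraticPart φ ξ ζ) η)
        + (1 / 4 : ℝ) • pr (G.bracketL (G.bracketL η ζ) ξ)
        - (1 / 4 : ℝ) • pr (G.bracketL (pr (G.bracketL η ζ)) ξ)
        + pr (G.bracketL (quadraticPart φ η ζ) ξ)) 0 := by
  have hφ_two : ContDiffAt ℝ 2 φ 0 := hφ.of_le (by norm_num)
  have hs := hasFDerivAt_sectionMap (hφ.differentiableAt three_ne_zero) hφ₁
  have hu_tendsto : Tendsto u (𝓝 0) (𝓝 0) := hu₀ ▸ hu.continuousAt
  have hdPsi : HasDerivAt (fun t => G.dPsi φ (u t)) (crossHessian (G.psi φ) ζ) 0 :=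
    HasFDerivAt.comp_hasDerivAt_of_eq (f := u) (l := G.dPsi φ) (0 : ℝ)
      (hasFDerivAt_dPsi hV hφ hφ₀ hφ₁) hu hu₀.symm
  have hg : HasDerivAt (fun t => sectionMap φ (u t)) (ζ : 𝔤) 0 :=
    hs.comp_hasDerivAt_of_eq 0 hu hu₀.symm
  refine (hasDerivAt_conjTorsion hV
    (hu_tendsto.eventually (eventually_contDiffAt_psi hV hφ hφ₀ hφ₁))
    (hu_tendsto.eventually (psi_zero_right hV hφ hφ₀ hφ₁))
    (by rw [hu₀]; exact dPsi_zero hV hφ hφ₀ hφ₁) hdPsi (by rw [hu₀, sectionMap_zero hφ₀]) hg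
    ξ η).congr_deriv ?_
  rw [coe_projectionOntoL_symm hV, quadraticPart_comm hφ_two ξ, quadraticPart_comm hφ_two η]
  simp only [crossHessian_psi hV hφ hφ₀ hφ₁ hG, map_add, map_sub, map_smul, add_apply, smul_apply,
    Submodule.projectionOntoL_apply_left, Submodule.projectionOntoL_apply_right]
  rw [G.bracketL_swap ξ (G.bracketL ζ η), G.bracketL_swap ξ (quadraticPart φ ζ η),
    G.bracketL_swap ξ (V.projectionOntoL 𝔥 hV (G.bracketL ζ η)),
    G.bracketL_swap ζ (G.bracketL ξ η), G.bracketL_jacobi ξ η ζ, G.bracketL_swap ζ ξ,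
    G.bracketL_swap ζ η]
  simp only [map_neg, map_sub, neg_apply, NegMemClass.coe_neg]
  module

end LocalLieGroup

open LocalLieGroup in
theorem mainTheorem3_general {𝔤 : Type*} [NormedAddCommGroup 𝔤] [NormedSpace ℝ 𝔤]
    [CompleteSpace 𝔤] (G : LocalLieGroup 𝔤) (hG : G.IsNormal)
    (V 𝔥 : Submodule ℝ 𝔤) (hV : V.IsTopCompl 𝔥) (h𝔥 : G.IsLocalSubgroup 𝔥)
    (φ : V → 𝔥) (hφ : ContDiffAt ℝ 3 φ 0) (hφ₀ : φ 0 = 0) (hφ₁ : fderiv ℝ φ 0 = 0) :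
    let pr : 𝔤 → V := V.projectionOntoL 𝔥 hV
    let br : 𝔤 → 𝔤 → 𝔤 := G.bracket
    let R : V → V → 𝔥 := quadraticPart φ
    let m : V → V → V := G.sectionLoop φ
    let F₂ : V → V → V → V := fun ξ η ζ =>
      -((1 / 2 : ℝ) • pr (br (br ξ η) ζ)) + (1 / 2 : ℝ) • pr (br (pr (br ξ η)) ζ)
    let F₁ : V → V → V → V := fun ξ η ζ =>
      -((1 / 4 : ℝ) • pr (br (br ξ ζ) η)) + (1 / 4 : ℝ) • pr (br (pr (br ξ ζ)) η)
        - pr (br (R ξ ζ) η)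
        + (1 / 4 : ℝ) • pr (br (br η ζ) ξ) - (1 / 4 : ℝ) • pr (br (pr (br η ζ)) ξ)
        + pr (br (R η ζ) ξ)
    (∀ᶠ g in 𝓝 (0 : 𝔤), IsCompl V (𝔥.map (G.Ad g).toLinearMap) ∧
      ∀ ξ η : V, (G.torsionTwo φ g ξ η : 𝔤)
        = -((1 / 2 : ℝ) • projAlong V (𝔥.map (G.Ad g).toLinearMap) (br ξ η))) ∧
    (∀ᶠ u in 𝓝 (0 : V), Function.Injective (G.dPsi φ u) ∧
      IsCompl (LinearMap.range (G.dPsi φ u).toLinearMap)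
        (𝔥.map (G.Ad (sectionMap φ u)).toLinearMap) ∧
      ∀ ξ η : V, G.dPsi φ u (G.torsionOne φ u ξ η)
        = -((1 / 2 : ℝ) • projAlong (LinearMap.range (G.dPsi φ u).toLinearMap)
            (𝔥.map (G.Ad (sectionMap φ u)).toLinearMap)
            (br (G.dPsi φ u ξ) (G.dPsi φ u η)))) ∧
    (∀ ξ : V, Asymptotics.IsLittleO (𝓝 (0 : V))
      (fun u : V => G.dPsi φ u ξ - ((ξ : 𝔤) + (1 / 2 : ℝ) • br u ξ
        + (1 / 2 : ℝ) • (pr (br u ξ) : 𝔤) + (2 : ℝ) • (R u ξ : 𝔤)))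
      (fun u : V => u)) ∧
    (∀ ξ η ζ : V,
      HasDerivAt (fun t : ℝ => G.torsionTwo φ (t • (ζ : 𝔤)) ξ η) (F₂ ξ η ζ) 0 ∧
      HasDerivAt (fun t : ℝ => G.torsionTwo φ (sectionMap φ (t • ζ)) ξ η) (F₂ ξ η ζ) 0 ∧
      nablaTwoTorsion m 0 ξ η ζ = F₂ ξ η ζ ∧
      nablaTwoTorsion m 0 ξ η ζ
        = (1 / 2 : ℝ) • (chernCurvature m 0 ξ η ζ - chernCurvature m 0 η ξ ζ)) ∧
    (∀ ξ η ζ : V,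
      HasDerivAt (fun t : ℝ => G.torsionOne φ (t • ζ) ξ η) (F₁ ξ η ζ) 0 ∧
      nablaOneTorsion m 0 ξ η ζ = F₁ ξ η ζ ∧
      nablaOneTorsion m 0 ξ η ζ
        = (1 / 2 : ℝ) • (chernCurvature m 0 ξ ζ η - chernCurvature m 0 η ζ ξ)) := by
  intro pr br R m F₂ F₁
  have hbr : br = fun x y => G.bracketL x y := by ext x y; exact G.bracket_eq_bracketL x y
  have : CompleteSpace V := hV.isClosed.completeSpace_coe
  have hloop : IsLocalLoop m := isLocalLoop_sectionLoop hV hφ hφ₀ hφ₁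
  have hs := hasFDerivAt_sectionMap (hφ.differentiableAt three_ne_zero) hφ₁
  have hline (ζ : V) : HasDerivAt (fun t : ℝ => t • ζ) ζ 0 := by
    simpa using (hasDerivAt_id (0 : ℝ)).smul_const ζ
  simp only [F₂, F₁, hbr]
  refine ⟨eventually_torsionTwo_eq hV hφ hφ₀ hφ₁, eventually_torsionOne_eq hV hφ hφ₀ hφ₁,
    isLittleO_dPsi hV hφ hφ₀ hφ₁ hG, fun ξ η ζ => ⟨?_, ?_, ?_, ?_⟩, fun ξ η ζ => ⟨?_, ?_, ?_⟩⟩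
  · exact hasDerivAt_torsionTwo hV hφ hφ₀ hφ₁ (zero_smul ℝ _)
      (V.subtypeL.hasFDerivAt.comp_hasDerivAt 0 (hline ζ)) ξ η
  · exact hasDerivAt_torsionTwo hV hφ hφ₀ hφ₁ (by simp [sectionMap_zero hφ₀])
      (hs.comp_hasDerivAt_of_eq (0 : ℝ) (hline ζ) (zero_smul ℝ ζ).symm) ξ η
  · exact nablaTwoTorsion_sectionLoop hV hφ hφ₀ hφ₁ hG h𝔥 ξ η ζ
  · exact hloop.nablaTwoTorsion_zero_eq_chernCurvature ξ η ζ
  · exact hasDerivAt_torsionOne hV hφ hφ₀ hφ₁ hG (zero_smul ℝ ζ) (hline ζ) ξ η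
  · exact nablaOneTorsion_sectionLoop hV hφ hφ₀ hφ₁ hG h𝔥 ξ η ζ
  · exact hloop.nablaOneTorsion_zero_eq_chernCurvature ξ η ζ

theorem mainTheorem3 {𝔤 : Type*} [NormedAddCommGroup 𝔤] [NormedSpace ℝ 𝔤] [FiniteDimensional ℝ 𝔤]
    (G : LocalLieGroup 𝔤) (hG : G.IsNormal)
    (V 𝔥 : Submodule ℝ 𝔤) (hV : IsCompl V 𝔥) (h𝔥 : G.IsLocalSubgroup 𝔥)
    (φ : V → 𝔥) (hφ : ∀ᶠ ξ in 𝓝 (0 : V), ContDiffAt ℝ ∞ φ ξ)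
    (hφ₀ : φ 0 = 0) (hφ₁ : fderiv ℝ φ 0 = 0) :
    let pr : 𝔤 → V := fun w => V.projectionOnto 𝔥 hV w
    let br : 𝔤 → 𝔤 → 𝔤 := G.bracket
    let R : V → V → 𝔥 := quadraticPart φ
    let m : V → V → V := G.sectionLoop φ
    let F₂ : V → V → V → V := fun ξ η ζ =>
      -((1 / 2 : ℝ) • pr (br (br ξ η) ζ)) + (1 / 2 : ℝ) • pr (br (pr (br ξ η)) ζ)
    let F₁ : V → V → V → V := fun ξ η ζ =>
      -((1 / 4 : ℝ) • pr (br (br ξ ζ) η)) + (1 / 4 : ℝ) • pr (br (pr (br ξ ζ)) η)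
        - pr (br (R ξ ζ) η)
        + (1 / 4 : ℝ) • pr (br (br η ζ) ξ) - (1 / 4 : ℝ) • pr (br (pr (br η ζ)) ξ)
        + pr (br (R η ζ) ξ)
    -- the torsion of the loops attached to the conjugated subgroups
    (∀ᶠ g in 𝓝 (0 : 𝔤), IsCompl V (𝔥.map (G.Ad g).toLinearMap) ∧
      ∀ ξ η : V, (G.torsionTwo φ g ξ η : 𝔤)
        = -((1 / 2 : ℝ) • projAlong V (𝔥.map (G.Ad g).toLinearMap) (br ξ η))) ∧
    (∀ᶠ u in 𝓝 (0 : V), Function.Injective (G.dPsi φ u) ∧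
      IsCompl (LinearMap.range (G.dPsi φ u).toLinearMap)
        (𝔥.map (G.Ad (sectionMap φ u)).toLinearMap) ∧
      ∀ ξ η : V, G.dPsi φ u (G.torsionOne φ u ξ η)
        = -((1 / 2 : ℝ) • projAlong (LinearMap.range (G.dPsi φ u).toLinearMap)
            (𝔥.map (G.Ad (sectionMap φ u)).toLinearMap)
            (br (G.dPsi φ u ξ) (G.dPsi φ u η)))) ∧
    -- the differential of `Ψ_u` to first order in `u`
    (∀ ξ : V, Asymptotics.IsLittleO (𝓝 (0 : V))
      (fun u : V => G.dPsi φ u ξ - ((ξ : 𝔤) + (1 / 2 : ℝ) • br u ξ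
        + (1 / 2 : ℝ) • (pr (br u ξ) : 𝔤) + (2 : ℝ) • (R u ξ : 𝔤)))
      (fun u : V => u)) ∧
    -- the two covariant derivatives of the torsion
    (∀ ξ η ζ : V,
      HasDerivAt (fun t : ℝ => G.torsionTwo φ (t • (ζ : 𝔤)) ξ η) (F₂ ξ η ζ) 0 ∧
      HasDerivAt (fun t : ℝ => G.torsionTwo φ (sectionMap φ (t • ζ)) ξ η) (F₂ ξ η ζ) 0 ∧
      nablaTwoTorsion m 0 ξ η ζ = F₂ ξ η ζ ∧
      nablaTwoTorsion m 0 ξ η ζ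
        = (1 / 2 : ℝ) • (chernCurvature m 0 ξ η ζ - chernCurvature m 0 η ξ ζ)) ∧
    (∀ ξ η ζ : V,
      HasDerivAt (fun t : ℝ => G.torsionOne φ (t • ζ) ξ η) (F₁ ξ η ζ) 0 ∧
      nablaOneTorsion m 0 ξ η ζ = F₁ ξ η ζ ∧
      nablaOneTorsion m 0 ξ η ζ
        = (1 / 2 : ℝ) • (chernCurvature m 0 ξ ζ η - chernCurvature m 0 η ζ ξ)) := by
  have : CompleteSpace 𝔤 := FiniteDimensional.complete ℝ 𝔤
  have hV' : V.IsTopCompl 𝔥 :=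
    Submodule.IsCompl.isTopCompl_of_isClosed_of_finiteDimensional hV V.closed_of_finiteDimensional
  exact mainTheorem3_general G hG V 𝔥 hV' h𝔥 φ
    (hφ.self_of_nhds.of_le (WithTop.coe_le_coe.2 le_top)) hφ₀ hφ₁
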